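/- All Banach spaces and scalars are real. For sequences $(e_i)_{i\ge1}$, $(f_i)_{i\ge1}$ in possibly different Banach spaces, $(e_i)$ *dominates* $(f_i)$ if there is a constant $C$ such that $\|\sum a_if_i\|\le C\|\sum a_ie_i\|$ for all finitely non-zero real sequences $(a_i)$. A *basic sequence* is a sequence $(e_i)$ that is a Schauder basis of its closed linear span $[e_i]$; its biorthogonal sequence $(e'_i)$ consists of the coordinate functionals $e'_i\in[e_i]'$, $e'_i(e_j)=\delta_{ij}$. A *block basis* of $(e_i)$ is a sequence of non-zero vectors $w_j=\sum_{i=p_j}^{p_{j+1}-1}a_ie_i$ with $1\le p_1<p_2<\cdots$ and real $a_i$; a sequence is *normalized* if all its terms have norm $1$. A basic sequence $(e_i)$ is *right dominant* if it is unconditional and there is a constant $C$ such that $$\Bigl\|\sum_i c_i e_{m(i)}\Bigr\|\le C\Bigl\|\sum_i c_i e_{n(i)}\Bigr\|$$ whenever $1\le m(1)\le n(1)<m(2)\le n(2)<\cdots$ and $(c_i)$ is a finitely non-zero real sequence. For a normalized unconditional basic sequence $(e_i)$, the James-type space $J(e_i)$ is the completion of the space of finitely non-zero real sequences, with unit vectors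 $(u_i)$, under the norm $$\Bigl\|\sum a_iu_i\Bigr\|=\sup\Bigl\{\Bigl\|\sum_{i=1}^k\Bigl(\sum_{j=p(i)}^{p(i+1)-1}a_j\Bigr)e_{p(i)}\Bigr\| : k\in\mathbb N,\ 1=p(1)<p(2)<\cdots<p(k+1)\Bigr\}.$$ **Theorem.** Let $(e_i)$ be a right dominant, normalized basic sequence in a Banach space which dominates each of its normalized block bases. Then the following are equivalent: (a) for every closed subspace $E$ of $J(e_i)$, every bounded linear operator $E\to J(e_i)'$ is compact; (b) $(e_i)$ does not dominate its biorthogonal sequence $(e'_i)$. -/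

import Mathlib

noncomputable section

/-- The closed linear span `[e_i]` of a sequence, as a subspace. -/
def closedSpan {X : Type*} [NormedAddCommGroup X] [NormedSpace ℝ X] (e : ℕ → X) :
    Submodule ℝ X :=
  (Submodule.span ℝ (Set.range e)).topologicalClosure

/-- `(e_i)` is a basic sequence: it is a Schauder basis of its closed linear span. -/
def IsBasicSequence {X : Type*} [NormedAddCommGroup X] [NormedSpace ℝ X] (e : ℕ → X) : Prop :=
  ∃ b : SchauderBasis ℝ (closedSpan e), ∀ i, (b i : X) = e i

/-- `(e_i)` is an unconditional basic sequence: it is a basis of its closed linear span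
all of whose expansions converge unconditionally. -/
def IsUnconditionalBasicSequence {X : Type*} [NormedAddCommGroup X] [NormedSpace ℝ X]
    (e : ℕ → X) : Prop :=
  ∃ b : UnconditionalSchauderBasis ℕ ℝ (closedSpan e), ∀ i, (b i : X) = e i

/-- The biorthogonal sequence `(e'_i)` of a basic sequence, in the dual of `[e_i]`. -/
def biorthogonal {X : Type*} [NormedAddCommGroup X] [NormedSpace ℝ X] {e : ℕ → X}
    (he : IsBasicSequence e) (i : ℕ) : StrongDual ℝ (closedSpan e) :=
  he.choose.coord i

theorem mem_closedSpan {X : Type*} [NormedAddCommGroup X] [NormedSpace ℝ X] (e : ℕ → X)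
    (i : ℕ) : e i ∈ closedSpan e :=
  Submodule.le_topologicalClosure _ (Submodule.subset_span ⟨i, rfl⟩)

theorem biorthogonal_apply {X : Type*} [NormedAddCommGroup X] [NormedSpace ℝ X] {e : ℕ → X}
    (he : IsBasicSequence e) (i j : ℕ) :
    biorthogonal he i ⟨e j, mem_closedSpan e j⟩ = if i = j then 1 else 0 := by
  have h : (⟨e j, mem_closedSpan e j⟩ : closedSpan e) = he.choose j :=
    Subtype.ext (he.choose_spec j).symm
  rw [h, biorthogonal, he.choose.ortho i j]
  simp [Pi.single_apply]

/-- `(e_i)` dominates `(f_i)` with constant `C`. -/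
def DominatesWith {X Y : Type*} [NormedAddCommGroup X] [NormedSpace ℝ X]
    [NormedAddCommGroup Y] [NormedSpace ℝ Y] (C : ℝ) (e : ℕ → X) (f : ℕ → Y) : Prop :=
  ∀ a : ℕ →₀ ℝ, ‖a.sum fun i t => t • f i‖ ≤ C * ‖a.sum fun i t => t • e i‖

/-- `(e_i)` dominates `(f_i)`. -/
def Dominates {X Y : Type*} [NormedAddCommGroup X] [NormedSpace ℝ X]
    [NormedAddCommGroup Y] [NormedSpace ℝ Y] (e : ℕ → X) (f : ℕ → Y) : Prop :=
  ∃ C : ℝ, DominatesWith C e f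

/-- Every term has norm one. -/
def IsNormalizedSeq {X : Type*} [NormedAddCommGroup X] (e : ℕ → X) : Prop :=
  ∀ i, ‖e i‖ = 1

/-- `(w_j)` is a block basis of `(e_i)`: nonzero linear combinations over successive
finite intervals of indices. -/
def IsBlockBasis {X : Type*} [NormedAddCommGroup X] [NormedSpace ℝ X] (e w : ℕ → X) : Prop :=
  ∃ (p : ℕ → ℕ) (a : ℕ → ℝ), StrictMono p ∧
    ∀ j, w j = ∑ i ∈ Finset.Ico (p j) (p (j + 1)), a i • e i ∧ w j ≠ 0

/-- Right dominance: `(e_i)` is an unconditional basic sequence and, for one constant `C`,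
`(e_{n(i)})` dominates `(e_{m(i)})` with constant `C` whenever
`m(0) ≤ n(0) < m(1) ≤ n(1) < ⋯`. -/
def IsRightDominant {X : Type*} [NormedAddCommGroup X] [NormedSpace ℝ X] (e : ℕ → X) : Prop :=
  IsUnconditionalBasicSequence e ∧
    ∃ C : ℝ, ∀ m n : ℕ → ℕ, (∀ i, m i ≤ n i) → (∀ i, n i < m (i + 1)) →
      DominatesWith C (fun i => e (n i)) (fun i => e (m i))

/-- The representative of `∑ a_j u_j` given by `p` and the number `k` of blocks. -/
def jamesRep {X : Type*} [NormedAddCommGroup X] [NormedSpace ℝ X] (e : ℕ → X) (k : ℕ)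
    (p : ℕ → ℕ) (a : ℕ →₀ ℝ) : X :=
  ∑ i ∈ Finset.range k, (∑ j ∈ Finset.Ico (p i) (p (i + 1)), a j) • e (p i)

/-- The norms of all representatives of `∑ a_j u_j`
(indices start at `0`, so the first block starts at `0`). -/
def jamesRepNorms {X : Type*} [NormedAddCommGroup X] [NormedSpace ℝ X] (e : ℕ → X)
    (a : ℕ →₀ ℝ) : Set ℝ :=
  {r | ∃ (k : ℕ) (p : ℕ → ℕ), p 0 = 0 ∧ StrictMono p ∧ r = ‖jamesRep e k p a‖}

theorem jamesRepNorms_nonempty {X : Type*} [NormedAddCommGroup X] [NormedSpace ℝ X]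
    (e : ℕ → X) (a : ℕ →₀ ℝ) : (jamesRepNorms e a).Nonempty :=
  ⟨_, 0, id, rfl, strictMono_id, rfl⟩

theorem jamesRepNorms_bddAbove {X : Type*} [NormedAddCommGroup X] [NormedSpace ℝ X]
    (e : ℕ → X) (a : ℕ →₀ ℝ) : BddAbove (jamesRepNorms e a) := by
  obtain ⟨N, hN⟩ : ∃ N, ∀ j, N ≤ j → a j = 0 := by
    refine ⟨a.support.sup id + 1, fun j hj => ?_⟩
    by_contra h
    have : j ≤ a.support.sup id := Finset.le_sup (f := id) (Finsupp.mem_support_iff.2 h)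
    omega
  set A : ℝ := ∑ j ∈ a.support, |a j| with hA
  have hA0 : 0 ≤ A := Finset.sum_nonneg fun _ _ => abs_nonneg _
  refine ⟨∑ q ∈ Finset.range N, A * ‖e q‖, ?_⟩
  rintro r ⟨k, p, -, hp, rfl⟩
  have hblock : ∀ i, |∑ j ∈ Finset.Ico (p i) (p (i + 1)), a j| ≤ A := by
    intro i
    have h1 : ∑ j ∈ Finset.Ico (p i) (p (i + 1)), |a j|
        = ∑ j ∈ (Finset.Ico (p i) (p (i + 1))).filter (· ∈ a.support), |a j| := by
      rw [Finset.sum_filter]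
      refine Finset.sum_congr rfl fun j _ => ?_
      by_cases h : j ∈ a.support
      · simp [h]
      · simp [Finsupp.notMem_support_iff.1 h]
    refine (Finset.abs_sum_le_sum_abs _ _).trans ?_
    rw [h1]
    refine Finset.sum_le_sum_of_subset_of_nonneg (fun j hj => (Finset.mem_filter.1 hj).2)
      fun _ _ _ => abs_nonneg _
  have hzero : ∀ i, N ≤ p i → ∑ j ∈ Finset.Ico (p i) (p (i + 1)), a j = 0 := fun i hi =>
    Finset.sum_eq_zero fun j hj => hN j (hi.trans (Finset.mem_Ico.1 hj).1)
  calc ‖jamesRep e k p a‖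
      ≤ ∑ i ∈ Finset.range k, ‖(∑ j ∈ Finset.Ico (p i) (p (i + 1)), a j) • e (p i)‖ :=
        norm_sum_le _ _
    _ ≤ ∑ i ∈ Finset.range k, if p i < N then A * ‖e (p i)‖ else 0 := by
        refine Finset.sum_le_sum fun i _ => ?_
        split_ifs with h
        · rw [norm_smul, Real.norm_eq_abs]
          exact mul_le_mul_of_nonneg_right (hblock i) (norm_nonneg _)
        · rw [hzero i (not_lt.1 h)]; simp
    _ = ∑ i ∈ (Finset.range k).filter (fun i => p i < N), A * ‖e (p i)‖ := by
        rw [Finset.sum_filter]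
    _ = ∑ q ∈ ((Finset.range k).filter (fun i => p i < N)).image p, A * ‖e q‖ := by
        rw [Finset.sum_image fun x _ y _ h => hp.injective h]
    _ ≤ ∑ q ∈ Finset.range N, A * ‖e q‖ := by
        refine Finset.sum_le_sum_of_subset_of_nonneg ?_ fun _ _ _ => by positivity
        intro q hq
        obtain ⟨i, hi, rfl⟩ := Finset.mem_image.1 hq
        exact Finset.mem_range.2 (Finset.mem_filter.1 hi).2

theorem jamesRep_add {X : Type*} [NormedAddCommGroup X] [NormedSpace ℝ X] (e : ℕ → X)
    (k : ℕ) (p : ℕ → ℕ) (a b : ℕ →₀ ℝ) :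
    jamesRep e k p (a + b) = jamesRep e k p a + jamesRep e k p b := by
  simp [jamesRep, Finset.sum_add_distrib, add_smul]

theorem jamesRep_smul {X : Type*} [NormedAddCommGroup X] [NormedSpace ℝ X] (e : ℕ → X)
    (k : ℕ) (p : ℕ → ℕ) (c : ℝ) (a : ℕ →₀ ℝ) :
    jamesRep e k p (c • a) = c • jamesRep e k p a := by
  simp [jamesRep, Finset.smul_sum, ← Finset.mul_sum, mul_smul]

/-- The norm of `∑ a_j u_j`: the supremum of the norms of its representatives. It is a norm as
soon as the `e_i` are linearly independent; it is a seminorm for every sequence. -/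
def jamesSeminorm {X : Type*} [NormedAddCommGroup X] [NormedSpace ℝ X] (e : ℕ → X) :
    Seminorm ℝ (ℕ →₀ ℝ) :=
  Seminorm.ofSMulLE (fun a => sSup (jamesRepNorms e a))
    (by
      refine le_antisymm (csSup_le (jamesRepNorms_nonempty e 0) ?_) (Real.sSup_nonneg ?_)
      · rintro r ⟨k, p, -, -, rfl⟩
        simp [jamesRep]
      · rintro r ⟨k, p, -, -, rfl⟩
        exact norm_nonneg _)
    (by
      intro a b
      refine csSup_le (jamesRepNorms_nonempty e _) ?_
      rintro r ⟨k, p, h0, hp, rfl⟩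
      rw [jamesRep_add]
      exact (norm_add_le _ _).trans (add_le_add
        (le_csSup (jamesRepNorms_bddAbove e a) ⟨k, p, h0, hp, rfl⟩)
        (le_csSup (jamesRepNorms_bddAbove e b) ⟨k, p, h0, hp, rfl⟩)))
    (by
      intro c a
      refine csSup_le (jamesRepNorms_nonempty e _) ?_
      rintro r ⟨k, p, h0, hp, rfl⟩
      rw [jamesRep_smul, norm_smul]
      exact mul_le_mul_of_nonneg_left
        (le_csSup (jamesRepNorms_bddAbove e a) ⟨k, p, h0, hp, rfl⟩) (norm_nonneg _))

/-- `c₀₀`, the linear span of `(u_i)` (with `u_i` the `i`-th unit vector), carrying the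
James type norm built on `(e_i)`. -/
def JamesPre {X : Type*} [NormedAddCommGroup X] [NormedSpace ℝ X] (_e : ℕ → X) : Type :=
  ℕ →₀ ℝ

instance JamesPre.instSeminormedAddCommGroup {X : Type*} [NormedAddCommGroup X] [NormedSpace ℝ X] (e : ℕ → X) :
    SeminormedAddCommGroup (JamesPre e) :=
  (jamesSeminorm e).toAddGroupSeminorm.toSeminormedAddCommGroup

instance JamesPre.instNormedSpace {X : Type*} [NormedAddCommGroup X] [NormedSpace ℝ X] (e : ℕ → X) :
    NormedSpace ℝ (JamesPre e) where
  toModule := inferInstanceAs (Module ℝ (ℕ →₀ ℝ))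
  norm_smul_le c a := ((jamesSeminorm e).smul' c a).le

theorem JamesPre.norm_def {X : Type*} [NormedAddCommGroup X] [NormedSpace ℝ X] (e : ℕ → X)
    (a : ℕ →₀ ℝ) : ‖(show JamesPre e from a)‖ = sSup (jamesRepNorms e a) :=
  rfl

/-- The James type space `J(e_i)`: the completion of the linear span of `(u_i)`. -/
abbrev JamesSpace {X : Type*} [NormedAddCommGroup X] [NormedSpace ℝ X] (e : ℕ → X) : Type :=
  UniformSpace.Completion (JamesPre e)

end

/-! If (e_i) dominates (e'_i), the maps u_i ↦ e_i ↦ e'_i compose to a bounded operator J(e_i) →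
[e_i]'; followed by the adjoint of u_j ↦ e_j it gives T : J(e_i) → J(e_i)' with T u_i (u_j) = δ_ij,
which is not compact.

For the converse, two facts carry the proof. (1) A bounded sequence in J(e_i) whose coordinates and
total sums tend to 0 has a subsequence dominated by (e_i) (`exists_dominated_subseq`). Up to a
summable error it consists of successive blocks with coordinate sum zero, and such blocks are
dominated (`dominates_zero_sum_blocks`): an interval containing a whole block contributes nothing,
and right dominance handles the one interval entering a block from the left and ending inside it.
(2) If (e_i) fails to dominate some bounded sequence, every sequence that it dominates is weakly
null (`tendsto_zero_of_dominates`). Otherwise its norm would control ∑|c_i|, and it would dominate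
every bounded sequence.

A noncompact T : E → J(e_i)' has separated values on a bounded sequence. By (1), differences of that
sequence give functionals η_k dominated by (e_i), with norms bounded below. Differences of almost
norming vectors give v_k dominated by (e_i) with η_k(v_k) bounded below. By (2), the off-diagonal
values η_i(v_j) become negligible along a subsequence. Pairing ∑ c_i η_i with ∑ d_i v_i then bounds
|∑ c_i d_i| by a multiple of ‖∑ c_i e_i‖ ‖∑ d_i e_i‖, which says that (e_i) dominates (e'_i). -/

open Filter Topology

/-! ### Domination, unconditionality and block bases -/

section Sequences

variable {X Y Z : Type*} [NormedAddCommGroup X] [NormedSpace ℝ X]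
  [NormedAddCommGroup Y] [NormedSpace ℝ Y] [NormedAddCommGroup Z] [NormedSpace ℝ Z]

theorem dominates_iff_finset (e : ℕ → X) (f : ℕ → Y) :
    Dominates e f ↔ ∃ K : ℝ, 0 ≤ K ∧ ∀ (s : Finset ℕ) (c : ℕ → ℝ),
      ‖∑ i ∈ s, c i • f i‖ ≤ K * ‖∑ i ∈ s, c i • e i‖ := by
  constructor
  · rintro ⟨K, hK⟩
    refine ⟨max K 0, le_max_right _ _, fun s c => ?_⟩
    have h := hK (Finsupp.onFinset s (fun i => if i ∈ s then c i else 0)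
      (fun i hi => by by_contra h; simp [h] at hi))
    rw [Finsupp.onFinset_sum _ (by simp), Finsupp.onFinset_sum _ (by simp)] at h
    have hc : ∑ i ∈ s, (if i ∈ s then c i else 0) • e i = ∑ i ∈ s, c i • e i :=
      Finset.sum_congr rfl fun i hi => by simp [hi]
    have hc' : ∑ i ∈ s, (if i ∈ s then c i else 0) • f i = ∑ i ∈ s, c i • f i :=
      Finset.sum_congr rfl fun i hi => by simp [hi]
    rw [hc, hc'] at h
    exact h.trans (mul_le_mul_of_nonneg_right (le_max_left _ _) (norm_nonneg _))
  · rintro ⟨K, -, hK⟩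
    exact ⟨K, fun a => hK a.support a⟩

theorem Dominates.trans {e : ℕ → X} {f : ℕ → Y} {g : ℕ → Z} (h : Dominates e f)
    (h' : Dominates f g) : Dominates e g := by
  obtain ⟨K, hK, h⟩ := (dominates_iff_finset _ _).1 h
  obtain ⟨K', hK', h'⟩ := (dominates_iff_finset _ _).1 h'
  refine (dominates_iff_finset _ _).2 ⟨K' * K, mul_nonneg hK' hK, fun s c => ?_⟩
  rw [mul_assoc]
  exact (h' s c).trans (mul_le_mul_of_nonneg_left (h s c) hK')

theorem Dominates.comp {e : ℕ → X} {f : ℕ → Y} (h : Dominates e f) {φ : ℕ → ℕ}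
    (hφ : StrictMono φ) : Dominates (e ∘ φ) (f ∘ φ) := by
  obtain ⟨K, hK, h⟩ := (dominates_iff_finset _ _).1 h
  refine (dominates_iff_finset _ _).2 ⟨K, hK, fun s c => ?_⟩
  have key := h (s.map ⟨φ, hφ.injective⟩) (fun i => c (Function.invFun φ i))
  simpa [Function.leftInverse_invFun hφ.injective _] using key

theorem Dominates.clm_comp {e : ℕ → X} {f : ℕ → Y} (h : Dominates e f) (T : Y →L[ℝ] Z) :
    Dominates e (fun i => T (f i)) := by
  obtain ⟨K, hK, h⟩ := (dominates_iff_finset _ _).1 h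
  refine (dominates_iff_finset _ _).2 ⟨‖T‖ * K, by positivity, fun s c => ?_⟩
  have : ∑ i ∈ s, c i • T (f i) = T (∑ i ∈ s, c i • f i) := by simp
  rw [this, mul_assoc]
  exact (T.le_opNorm _).trans (mul_le_mul_of_nonneg_left (h s c) (norm_nonneg _))

/-- `B` bounds the norms of all coordinate projections on the linear span of `(e_i)`. -/
def IsSuppressionBound (e : ℕ → X) (B : ℝ) : Prop :=
  0 ≤ B ∧ ∀ (s t : Finset ℕ) (c : ℕ → ℝ), t ⊆ s →
    ‖∑ i ∈ t, c i • e i‖ ≤ B * ‖∑ i ∈ s, c i • e i‖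

theorem isClosed_closedSpan (e : ℕ → X) : IsClosed (closedSpan e : Set X) :=
  Submodule.isClosed_topologicalClosure _

theorem coord_apply_sum {e : ℕ → X} {L : SummationFilter ℕ}
    (b : GeneralSchauderBasis ℕ ℝ (closedSpan e) L)
    (s : Finset ℕ) (c : ℕ → ℝ) (i : ℕ) :
    b.coord i (∑ j ∈ s, c j • b j) = if i ∈ s then c i else 0 := by
  simp [b.ortho, Pi.single_apply]

theorem IsUnconditionalBasicSequence.exists_suppressionBound [CompleteSpace X] {e : ℕ → X}
    (he : IsUnconditionalBasicSequence e) : ∃ B, IsSuppressionBound e B := by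
  obtain ⟨b, hb⟩ := he
  have : CompleteSpace (closedSpan e) := (isClosed_closedSpan e).completeSpace_coe
  obtain ⟨B, hB⟩ := b.exists_norm_proj_le
  refine ⟨B, (norm_nonneg _).trans (hB ∅), fun s t c hts => ?_⟩
  have hcoe : ∀ r : Finset ℕ, ((∑ i ∈ r, c i • b i : closedSpan e) : X) = ∑ i ∈ r, c i • e i :=
    fun r => by simp [hb]
  have hp : b.proj t (∑ i ∈ s, c i • b i) = ∑ i ∈ t, c i • b i := by
    rw [GeneralSchauderBasis.proj_apply]
    exact Finset.sum_congr rfl fun i hi => by rw [coord_apply_sum, if_pos (hts hi)]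
  have h := (b.proj t).le_of_opNorm_le (hB t) (∑ i ∈ s, c i • b i)
  rwa [hp, ← Submodule.norm_coe, ← Submodule.norm_coe, hcoe, hcoe] at h

/-- Splitting `s` by the sign of `c i * f (e i)` leaves two sums without cancellation, each
controlled by one coordinate projection; hence the factor 2. -/
theorem IsSuppressionBound.sum_abs_le {e : ℕ → X} {B : ℝ} (hB : IsSuppressionBound e B)
    (s : Finset ℕ) (c : ℕ → ℝ) (f : StrongDual ℝ X) (hf : ‖f‖ ≤ 1) :
    ∑ i ∈ s, |c i * f (e i)| ≤ 2 * B * ‖∑ i ∈ s, c i • e i‖ := by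
  have key : ∀ t ⊆ s, |∑ i ∈ t, c i * f (e i)| ≤ B * ‖∑ i ∈ s, c i • e i‖ := by
    intro t ht
    have : ∑ i ∈ t, c i * f (e i) = f (∑ i ∈ t, c i • e i) := by simp
    rw [this, ← Real.norm_eq_abs]
    exact ((f.le_of_opNorm_le hf _).trans (by rw [one_mul])).trans (hB.2 s t c ht)
  rw [← Finset.sum_filter_add_sum_filter_not s (fun i => 0 ≤ c i * f (e i))]
  have h1 : ∑ i ∈ s with 0 ≤ c i * f (e i), |c i * f (e i)|
      = ∑ i ∈ s with 0 ≤ c i * f (e i), c i * f (e i) :=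
    Finset.sum_congr rfl fun i hi => abs_of_nonneg (Finset.mem_filter.1 hi).2
  have h2 : ∑ i ∈ s with ¬ 0 ≤ c i * f (e i), |c i * f (e i)|
      = - ∑ i ∈ s with ¬ 0 ≤ c i * f (e i), c i * f (e i) := by
    rw [← Finset.sum_neg_distrib]
    exact Finset.sum_congr rfl fun i hi => abs_of_neg (not_le.1 (Finset.mem_filter.1 hi).2)
  rw [h1, h2]
  have k1 := (le_abs_self _).trans (key _ (Finset.filter_subset (fun i => 0 ≤ c i * f (e i)) s))
  have k2 := (neg_le_abs _).trans (key _ (Finset.filter_subset (fun i => ¬ 0 ≤ c i * f (e i)) s))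
  linarith

theorem IsSuppressionBound.norm_sum_mul_le {e : ℕ → X} {B : ℝ} (hB : IsSuppressionBound e B)
    (s : Finset ℕ) (t c : ℕ → ℝ) {R : ℝ} (ht : ∀ i ∈ s, |t i| ≤ R) :
    ‖∑ i ∈ s, (t i * c i) • e i‖ ≤ 2 * B * R * ‖∑ i ∈ s, c i • e i‖ := by
  rcases s.eq_empty_or_nonempty with rfl | ⟨j, hj⟩
  · simp
  have hR : 0 ≤ R := (abs_nonneg _).trans (ht j hj)
  obtain ⟨f, hf, hfx⟩ := exists_dual_vector'' ℝ (∑ i ∈ s, (t i * c i) • e i)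
  rw [RCLike.ofReal_real_eq_id, id] at hfx
  rw [← hfx, map_sum]
  calc ∑ i ∈ s, f ((t i * c i) • e i) ≤ ∑ i ∈ s, R * |c i * f (e i)| := by
        refine Finset.sum_le_sum fun i hi => ?_
        rw [map_smul, smul_eq_mul, mul_assoc]
        refine (le_abs_self _).trans ?_
        rw [abs_mul]
        exact mul_le_mul_of_nonneg_right (ht i hi) (abs_nonneg _)
    _ = R * ∑ i ∈ s, |c i * f (e i)| := by rw [Finset.mul_sum]
    _ ≤ R * (2 * B * ‖∑ i ∈ s, c i • e i‖) :=
        mul_le_mul_of_nonneg_left (hB.sum_abs_le s c f hf) hR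
    _ = _ := by ring

theorem IsSuppressionBound.abs_coeff_le {e : ℕ → X} {B : ℝ} (hB : IsSuppressionBound e B)
    (hnorm : IsNormalizedSeq e) (s : Finset ℕ) (c : ℕ → ℝ) {i : ℕ} (hi : i ∈ s) :
    |c i| ≤ B * ‖∑ i ∈ s, c i • e i‖ := by
  have := hB.2 s {i} c (by simpa using hi)
  simpa [norm_smul, hnorm i] using this

theorem isBlockBasis_subseq {e : ℕ → X} (hnorm : IsNormalizedSeq e) {φ : ℕ → ℕ}
    (hφ : StrictMono φ) : IsBlockBasis e (e ∘ φ) := by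
  classical
  refine ⟨φ, fun i => if i ∈ Set.range φ then 1 else 0, hφ, fun j => ⟨?_, fun h => ?_⟩⟩
  · have hmem : φ j ∈ Finset.Ico (φ j) (φ (j + 1)) :=
      Finset.mem_Ico.2 ⟨le_rfl, hφ (Nat.lt_succ_self j)⟩
    rw [Finset.sum_eq_single_of_mem _ hmem]
    · simp
    · rintro i hi hne
      beta_reduce
      rw [if_neg, zero_smul]
      rintro ⟨k, rfl⟩
      obtain ⟨h1, h2⟩ := Finset.mem_Ico.1 hi
      have h3 := hφ.le_iff_le.1 h1
      have h4 := hφ.lt_iff_lt.1 h2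
      exact hne (by rw [show k = j by omega])
  · have := hnorm (φ j)
    rw [Function.comp_apply] at h
    simp [h] at this

variable {e : ℕ → X}

theorem dominates_subseq (hnorm : IsNormalizedSeq e)
    (hblock : ∀ w : ℕ → X, IsBlockBasis e w → IsNormalizedSeq w → Dominates e w)
    {φ : ℕ → ℕ} (hφ : StrictMono φ) : Dominates e (e ∘ φ) :=
  hblock _ (isBlockBasis_subseq hnorm hφ) fun i => hnorm (φ i)

/-- If `(e_i)` dominates `(y_i)`, it also dominates the subsequences of `(y_i)`. -/
theorem Dominates.subseq {y : ℕ → Y} (h : Dominates e y) (hnorm : IsNormalizedSeq e)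
    (hblock : ∀ w : ℕ → X, IsBlockBasis e w → IsNormalizedSeq w → Dominates e w)
    {φ : ℕ → ℕ} (hφ : StrictMono φ) : Dominates e (y ∘ φ) :=
  (dominates_subseq hnorm hblock hφ).trans (h.comp hφ)

theorem mem_span_Ico {a b : ℕ} {v : X} (hv : v ∈ Submodule.span ℝ (e '' Set.Ico a b)) :
    ∃ c : ℕ → ℝ, v = ∑ i ∈ Finset.Ico a b, c i • e i := by
  rw [← Finset.coe_Ico, Submodule.mem_span_image_finset_iff_exists_fun'] at hv
  obtain ⟨c, hc⟩ := hv
  exact ⟨c, hc.symm⟩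

/-- Normalizing the blocks reduces this to the hypothesis on block bases; the factors `‖v j‖ ≤ R`
are bounded multipliers, absorbed by unconditionality. -/
theorem dominates_bounded_blocks [CompleteSpace X] {B : ℝ} (hB : IsSuppressionBound e B)
    (hnorm : IsNormalizedSeq e)
    (hblock : ∀ w : ℕ → X, IsBlockBasis e w → IsNormalizedSeq w → Dominates e w)
    {p : ℕ → ℕ} (hp : StrictMono p) {v : ℕ → X} {R : ℝ}
    (hv : ∀ j, v j ∈ Submodule.span ℝ (e '' Set.Ico (p j) (p (j + 1)))) (hvR : ∀ j, ‖v j‖ ≤ R) :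
    Dominates e v := by
  classical
  -- A zero block cannot be normalized, so a unit vector from its interval takes its place; its
  -- factor `‖v j‖ = 0` removes it again.
  set w : ℕ → X := fun j => if v j = 0 then e (p j) else ‖v j‖⁻¹ • v j with hw
  have hvw : ∀ j, v j = ‖v j‖ • w j := by
    intro j
    by_cases h : v j = 0
    · simp [h]
    · simp only [hw, if_neg h]
      rw [smul_smul, mul_inv_cancel₀ (norm_ne_zero_iff.2 h), one_smul]
  have hwn : IsNormalizedSeq w := by
    intro j
    by_cases h : v j = 0
    · simp only [hw, if_pos h]; exact hnorm _
    · simp only [hw, if_neg h]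
      rw [norm_smul, norm_inv, norm_norm, inv_mul_cancel₀ (norm_ne_zero_iff.2 h)]
  have hwspan : ∀ j, w j ∈ Submodule.span ℝ (e '' Set.Ico (p j) (p (j + 1))) := by
    intro j
    by_cases h : v j = 0
    · simp only [hw, if_pos h]
      exact Submodule.subset_span ⟨p j, ⟨le_rfl, hp (Nat.lt_succ_self j)⟩, rfl⟩
    · simp only [hw, if_neg h]
      exact Submodule.smul_mem _ _ (hv j)
  choose c hc using fun j => mem_span_Ico (hwspan j)
  have huniq : ∀ i j k, i ∈ Finset.Ico (p j) (p (j + 1)) → i ∈ Finset.Ico (p k) (p (k + 1)) →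
      j = k := by
    intro i j k h1 h2
    rw [Finset.mem_Ico] at h1 h2
    have h3 := hp.lt_iff_lt.1 (h1.1.trans_lt h2.2)
    have h4 := hp.lt_iff_lt.1 (h2.1.trans_lt h1.2)
    omega
  have hwb : IsBlockBasis e w := by
    refine ⟨p, fun i => if h : ∃ j, i ∈ Finset.Ico (p j) (p (j + 1)) then c h.choose i else 0,
      hp, fun j => ⟨?_, fun h => ?_⟩⟩
    · rw [hc j]
      refine Finset.sum_congr rfl fun i hi => ?_
      have h : ∃ j, i ∈ Finset.Ico (p j) (p (j + 1)) := ⟨j, hi⟩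
      beta_reduce
      rw [dif_pos h, huniq i _ _ h.choose_spec hi]
    · have := hwn j
      simp [h] at this
  obtain ⟨K, hK, hdom⟩ := (dominates_iff_finset _ _).1 (hblock w hwb hwn)
  have hR : 0 ≤ R := (norm_nonneg _).trans (hvR 0)
  refine (dominates_iff_finset _ _).2
    ⟨K * (2 * B * R), mul_nonneg hK (mul_nonneg (mul_nonneg two_pos.le hB.1) hR), fun s d => ?_⟩
  have h1 : ∑ j ∈ s, d j • v j = ∑ j ∈ s, (‖v j‖ * d j) • w j :=
    Finset.sum_congr rfl fun j _ => by rw [hvw j, smul_smul, ← hvw j, mul_comm]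
  rw [h1, mul_assoc]
  refine (hdom s _).trans (mul_le_mul_of_nonneg_left ?_ hK)
  exact hB.norm_sum_mul_le s _ d fun j _ => by simpa using hvR j

/-- The blocks over given intervals are dominated by `(e_i)` with a common constant. -/
theorem exists_uniform_block_bound [CompleteSpace X] {B : ℝ} (hB : IsSuppressionBound e B)
    (hnorm : IsNormalizedSeq e)
    (hblock : ∀ w : ℕ → X, IsBlockBasis e w → IsNormalizedSeq w → Dominates e w)
    {p : ℕ → ℕ} (hp : StrictMono p) : ∃ K, 0 ≤ K ∧ ∀ (R : ℝ) (v : ℕ → X),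
      (∀ j, v j ∈ Submodule.span ℝ (e '' Set.Ico (p j) (p (j + 1)))) → (∀ j, ‖v j‖ ≤ R) →
      ∀ (s : Finset ℕ) (c : ℕ → ℝ), ‖∑ j ∈ s, c j • v j‖ ≤ K * R * ‖∑ j ∈ s, c j • e j‖ := by
  -- Uniform boundedness on the ℓ^∞-sum of the block spans: the operators x ↦ ∑ c_j x_j, indexed by
  -- finite c with ‖∑ c_j e_j‖ ≤ 1, are pointwise bounded by `dominates_bounded_blocks`.
  let F : ℕ → Submodule ℝ X := fun j => Submodule.span ℝ (e '' Set.Ico (p j) (p (j + 1)))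
  have : ∀ j, FiniteDimensional ℝ (F j) := fun j =>
    FiniteDimensional.span_of_finite ℝ ((Set.finite_Ico _ _).image e)
  have : ∀ j, CompleteSpace (F j) := fun j => FiniteDimensional.complete ℝ _
  let ι := {q : Finset ℕ × (ℕ → ℝ) // ‖∑ j ∈ q.1, q.2 j • e j‖ ≤ 1}
  let g : ι → (lp (fun j => F j) ⊤ →L[ℝ] X) := fun q =>
    ∑ j ∈ q.1.1, q.1.2 j • ((F j).subtypeL.comp (lp.evalCLM ℝ (fun j => F j) ⊤ j))
  have hg : ∀ q x, g q x = ∑ j ∈ q.1.1, q.1.2 j • (x j : X) := by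
    intro q x
    simp only [g, _root_.sum_apply]
    rfl
  obtain ⟨K, hK⟩ := banach_steinhaus (g := g) (fun x => by
    have hd : Dominates e (fun j => (x j : X)) :=
      dominates_bounded_blocks hB hnorm hblock hp (R := ‖x‖) (fun j => (x j).2)
        fun j => lp.norm_apply_le_norm ENNReal.top_ne_zero x j
    obtain ⟨K, hK, hdom⟩ := (dominates_iff_finset _ _).1 hd
    refine ⟨K, fun q => ?_⟩
    rw [hg]
    exact (hdom _ _).trans (mul_le_of_le_one_right hK q.2))
  have hK0 : 0 ≤ K := (norm_nonneg _).trans (hK ⟨(∅, 0), by simp⟩)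
  refine ⟨K, hK0, fun R v hv hR s c => ?_⟩
  have hR0 : 0 ≤ R := (norm_nonneg _).trans (hR 0)
  have hmem : Memℓp (fun j => (⟨v j, hv j⟩ : F j)) ⊤ := memℓp_infty ⟨R, by
    rintro _ ⟨j, rfl⟩; exact hR j⟩
  let x : lp (fun j => F j) ⊤ := ⟨fun j => ⟨v j, hv j⟩, hmem⟩
  have hx : ‖x‖ ≤ R := lp.norm_le_of_forall_le hR0 fun j => hR j
  set r := ‖∑ j ∈ s, c j • e j‖ with hr
  rcases (norm_nonneg (∑ j ∈ s, c j • e j)).eq_or_lt with h0 | h0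
  · have : ∑ j ∈ s, c j • v j = 0 := Finset.sum_eq_zero fun j hj => by
      have := hB.abs_coeff_le hnorm s c hj
      rw [← h0, mul_zero] at this
      rw [abs_nonpos_iff.1 this, zero_smul]
    rw [this, norm_zero]
    positivity
  · rw [← hr] at h0
    have hq : ‖∑ j ∈ s, (r⁻¹ * c j) • e j‖ ≤ 1 := by
      simp only [mul_smul, ← Finset.smul_sum]
      rw [norm_smul, ← hr, norm_inv, Real.norm_of_nonneg h0.le, inv_mul_cancel₀ h0.ne']
    have := (g ⟨(s, fun j => r⁻¹ * c j), hq⟩).le_of_opNorm_le (hK _) x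
    rw [hg] at this
    simp only [mul_smul, ← Finset.smul_sum] at this
    rw [norm_smul, norm_inv, Real.norm_of_nonneg h0.le, inv_mul_le_iff₀ h0] at this
    calc ‖∑ j ∈ s, c j • v j‖ ≤ r * (K * ‖x‖) := this
      _ ≤ r * (K * R) := by gcongr
      _ = _ := by ring

/-- Transfers right dominance from infinite sequences of indices to finite families labelled by any
finite set. -/
theorem IsRightDominant.exists_finset_bound (h : IsRightDominant e) : ∃ C, 0 ≤ C ∧
    ∀ (s : Finset ℕ) (m n : ℕ → ℕ), (∀ j ∈ s, m j ≤ n j) →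
      (∀ j ∈ s, ∀ k ∈ s, j < k → n j < m k) → ∀ c : ℕ → ℝ,
      ‖∑ j ∈ s, c j • e (m j)‖ ≤ C * ‖∑ j ∈ s, c j • e (n j)‖ := by
  obtain ⟨-, C, hC⟩ := h
  refine ⟨max C 0, le_max_right _ _, fun s m n hmn hlt c => ?_⟩
  set L := s.sup n + 1 with hL
  let o := s.orderEmbOfFin rfl
  -- Past the last element of `s`, both index sequences continue as `L + i`, beyond all values of
  -- `n` on `s`, so the interlacing persists.
  let ext : (ℕ → ℕ) → ℕ → ℕ := fun f i => if h : i < s.card then f (o ⟨i, h⟩) else L + i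
  have ho : ∀ i, o i ∈ s := fun i => Finset.orderEmbOfFin_mem s rfl i
  have h1 : ∀ i, ext m i ≤ ext n i := by
    intro i
    by_cases h : i < s.card
    · simp only [ext, dif_pos h]; exact hmn _ (ho _)
    · simp only [ext, dif_neg h]; exact le_rfl
  have h2 : ∀ i, ext n i < ext m (i + 1) := by
    intro i
    by_cases h : i + 1 < s.card
    · have h' : i < s.card := by omega
      simp only [ext, dif_pos h, dif_pos h']
      exact hlt _ (ho _) _ (ho _) (o.strictMono (by simp [Fin.lt_def]))
    · by_cases h' : i < s.card
      · simp only [ext, dif_neg h, dif_pos h']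
        have := Finset.le_sup (f := n) (ho ⟨i, h'⟩)
        omega
      · simp only [ext, dif_neg h, dif_neg h']
        omega
  obtain hd := hC (ext m) (ext n) h1 h2
  have hd' := hd (Finsupp.onFinset (Finset.range s.card)
    (fun i => if h : i < s.card then c (o ⟨i, h⟩) else 0)
    (fun i hi => by by_contra h; simp at h; simp [h.not_gt] at hi))
  rw [Finsupp.onFinset_sum _ (by simp), Finsupp.onFinset_sum _ (by simp)] at hd'
  have hsum : ∀ f : ℕ → ℕ, ∑ i ∈ Finset.range s.card,
      (if h : i < s.card then c (o ⟨i, h⟩) else 0) • e (ext f i) = ∑ j ∈ s, c j • e (f j) := by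
    intro f
    rw [Finset.sum_range]
    simp only [ext, Fin.is_lt, dif_pos, Fin.eta]
    have : s = Finset.univ.map o.toEmbedding := by
      ext j; simp [o]
    conv_rhs => rw [this, Finset.sum_map]
    rfl
  rw [hsum, hsum] at hd'
  exact hd'.trans (mul_le_mul_of_nonneg_right (le_max_left _ _) (norm_nonneg _))

end Sequences

/-! ### The James-type space and its zero-sum blocks -/

section James

variable {X Y : Type*} [NormedAddCommGroup X] [NormedSpace ℝ X]
  [NormedAddCommGroup Y] [NormedSpace ℝ Y]

/-- Each coefficient is at most `B` times the norm of the sum, so errors of summable size cost only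
a constant. -/
theorem dominates_of_perturbation {e : ℕ → X} {B : ℝ} (hB : IsSuppressionBound e B)
    (hnorm : IsNormalizedSeq e) {y z : ℕ → Y} (hyz : ∀ j, ‖y j - z j‖ ≤ (1 / 2 : ℝ) ^ j)
    (h : Dominates e z) : Dominates e y := by
  obtain ⟨K, hK, h⟩ := (dominates_iff_finset _ _).1 h
  have hB0 := hB.1
  refine (dominates_iff_finset _ _).2 ⟨K + B * 2, by positivity, fun s c => ?_⟩
  have h1 : ∑ j ∈ s, c j • y j = ∑ j ∈ s, c j • z j + ∑ j ∈ s, c j • (y j - z j) := by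
    rw [← Finset.sum_add_distrib]
    exact Finset.sum_congr rfl fun j _ => by rw [smul_sub]; abel
  rw [h1, add_mul]
  refine (norm_add_le _ _).trans (add_le_add (h s c) ?_)
  set r := ‖∑ j ∈ s, c j • e j‖
  calc ‖∑ j ∈ s, c j • (y j - z j)‖ ≤ ∑ j ∈ s, B * r * (1 / 2 : ℝ) ^ j := by
        refine norm_sum_le_of_le _ fun j hj => ?_
        rw [norm_smul]
        exact mul_le_mul (hB.abs_coeff_le hnorm s c hj) (hyz j) (norm_nonneg _) (by positivity)
    _ = B * r * ∑ j ∈ s, (1 / 2 : ℝ) ^ j := by rw [Finset.mul_sum]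
    _ ≤ B * r * 2 := by
        refine mul_le_mul_of_nonneg_left ?_ (by positivity)
        exact (summable_geometric_two.sum_le_tsum _ fun _ _ => by positivity).trans_eq
          tsum_geometric_two
    _ = _ := by ring

/-- The canonical map from finitely supported sequences to the James type space. -/
noncomputable def JamesSpace.ofFinsupp (e : ℕ → X) : (ℕ →₀ ℝ) →ₗ[ℝ] JamesSpace e :=
  (UniformSpace.Completion.toComplL (𝕜 := ℝ) (E := JamesPre e)).toLinearMap

namespace JamesSpace

variable {e : ℕ → X}

theorem norm_ofFinsupp (e : ℕ → X) (a : ℕ →₀ ℝ) :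
    ‖ofFinsupp e a‖ = sSup (jamesRepNorms e a) :=
  UniformSpace.Completion.norm_coe (E := JamesPre e) a

theorem denseRange_ofFinsupp (e : ℕ → X) : DenseRange (ofFinsupp e) :=
  UniformSpace.Completion.denseRange_coe (α := JamesPre e)

theorem norm_jamesRep_le (e : ℕ → X) (a : ℕ →₀ ℝ) (k : ℕ) {p : ℕ → ℕ} (h0 : p 0 = 0)
    (hp : StrictMono p) : ‖jamesRep e k p a‖ ≤ ‖ofFinsupp e a‖ := by
  rw [norm_ofFinsupp]
  exact le_csSup (jamesRepNorms_bddAbove e a) ⟨k, p, h0, hp, rfl⟩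

theorem norm_ofFinsupp_le {a : ℕ →₀ ℝ} {M : ℝ}
    (h : ∀ (k : ℕ) (p : ℕ → ℕ), p 0 = 0 → StrictMono p → ‖jamesRep e k p a‖ ≤ M) :
    ‖ofFinsupp e a‖ ≤ M := by
  rw [norm_ofFinsupp]
  refine csSup_le (jamesRepNorms_nonempty e a) ?_
  rintro r ⟨k, p, h0, hp, rfl⟩
  exact h k p h0 hp

theorem abs_sum_range_le (hnorm : IsNormalizedSeq e) (a : ℕ →₀ ℝ) (n : ℕ) :
    |∑ l ∈ Finset.range n, a l| ≤ ‖ofFinsupp e a‖ := by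
  rcases n.eq_zero_or_pos with rfl | hn
  · simp
  -- One block [0, n): its representative is the initial sum times `e 0`.
  have h := norm_jamesRep_le e a 1 (p := fun i => i * n) (by simp)
    (fun i j h => Nat.mul_lt_mul_of_pos_right h hn)
  simpa [jamesRep, norm_smul, hnorm 0] using h

theorem norm_sum_smul_le (e : ℕ → X) (a : ℕ →₀ ℝ) :
    ‖a.sum fun i t => t • e i‖ ≤ ‖ofFinsupp e a‖ := by
  have h := norm_jamesRep_le e a (a.support.sup id + 1) (p := id) rfl strictMono_id
  have h1 : jamesRep e (a.support.sup id + 1) id a = a.sum fun i t => t • e i := by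
    rw [Finsupp.sum_of_support_subset a (s := Finset.range (a.support.sup id + 1))
      (fun i hi => Finset.mem_range_succ_iff.2 (Finset.le_sup (f := id) hi)) _ (by simp)]
    simp [jamesRep]
  rwa [h1] at h

theorem exists_sum_range_eq (a : ℕ →₀ ℝ) :
    ∃ N, (a.sum fun _ t => t) = ∑ l ∈ Finset.range N, a l :=
  ⟨a.support.sup id + 1, Finsupp.sum_of_support_subset a
    (fun i hi => Finset.mem_range_succ_iff.2 (Finset.le_sup (f := id) hi)) _ (by simp)⟩

/-- The coordinate functionals of the James type space. -/
noncomputable def coord (e : ℕ → X) (n : ℕ) : StrongDual ℝ (JamesSpace e) :=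
  (Finsupp.lapply n : (ℕ →₀ ℝ) →ₗ[ℝ] ℝ).extendOfNorm (ofFinsupp e)

/-- The functional summing all coordinates. -/
noncomputable def total (e : ℕ → X) : StrongDual ℝ (JamesSpace e) :=
  (Finsupp.linearCombination ℝ fun _ => (1 : ℝ)).extendOfNorm (ofFinsupp e)

theorem coord_ofFinsupp (hnorm : IsNormalizedSeq e) (n : ℕ) (a : ℕ →₀ ℝ) :
    coord e n (ofFinsupp e a) = a n := by
  -- A coordinate is the difference of two initial sums, hence the constant 2.
  refine LinearMap.extendOfNorm_eq (denseRange_ofFinsupp e) ⟨2, fun a => ?_⟩ a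
  have h1 := abs_sum_range_le hnorm a (n + 1)
  have h2 := abs_sum_range_le hnorm a n
  rw [Finset.sum_range_succ] at h1
  have h3 := abs_sub (∑ l ∈ Finset.range n, a l + a n) (∑ l ∈ Finset.range n, a l)
  rw [add_sub_cancel_left] at h3
  rw [Finsupp.lapply_apply, Real.norm_eq_abs]
  linarith

theorem total_ofFinsupp (hnorm : IsNormalizedSeq e) (a : ℕ →₀ ℝ) :
    total e (ofFinsupp e a) = a.sum fun _ t => t := by
  have h : ∀ a : ℕ →₀ ℝ, Finsupp.linearCombination ℝ (fun _ => (1 : ℝ)) a = a.sum fun _ t => t :=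
    fun a => by simp [Finsupp.linearCombination_apply]
  rw [← h]
  refine LinearMap.extendOfNorm_eq (denseRange_ofFinsupp e) ⟨1, fun a => ?_⟩ a
  obtain ⟨N, hN⟩ := exists_sum_range_eq a
  rw [h, hN, one_mul]
  exact abs_sum_range_le hnorm a N

theorem jamesRep_sum (e : ℕ → X) (k : ℕ) (p : ℕ → ℕ) (s : Finset ℕ) (c : ℕ → ℝ)
    (w : ℕ → ℕ →₀ ℝ) :
    jamesRep e k p (∑ j ∈ s, c j • w j) = ∑ j ∈ s, c j • jamesRep e k p (w j) := by
  let f : (ℕ →₀ ℝ) →ₗ[ℝ] X := ⟨⟨jamesRep e k p, jamesRep_add e k p⟩, jamesRep_smul e k p⟩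
  change f _ = ∑ j ∈ s, c j • f (w j)
  simp

/-- For a fixed representative `q`, the intervals starting inside block `j` give a bounded vector on
that block. Of the others, only an interval that starts before the block and ends strictly inside it
can contribute, since zero sum cancels full coverings. -/
theorem dominates_zero_sum_blocks [CompleteSpace X] {B : ℝ} (hB : IsSuppressionBound e B)
    (hnorm : IsNormalizedSeq e) (hright : IsRightDominant e)
    (hblock : ∀ w : ℕ → X, IsBlockBasis e w → IsNormalizedSeq w → Dominates e w)
    {p : ℕ → ℕ} (hp : StrictMono p) {w : ℕ → ℕ →₀ ℝ}
    (hlow : ∀ j l, l < p j → w j l = 0) (hhigh : ∀ j l, p (j + 1) ≤ l → w j l = 0)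
    (hsum : ∀ j, ∑ l ∈ Finset.Ico (p j) (p (j + 1)), w j l = 0) {R : ℝ}
    (hR : ∀ j, ‖ofFinsupp e (w j)‖ ≤ R) : Dominates e fun j => ofFinsupp e (w j) := by
  classical
  have hB0 := hB.1
  have hR0 : 0 ≤ R := (norm_nonneg _).trans (hR 0)
  -- The blocks cut out below depend on `q`, so a constant common to all of them is needed.
  obtain ⟨K, hK, huniform⟩ := exists_uniform_block_bound hB hnorm hblock hp
  obtain ⟨C, hC, hrd⟩ := hright.exists_finset_bound
  obtain ⟨K', hK', hsub⟩ := (dominates_iff_finset _ _).1 (dominates_subseq hnorm hblock hp)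
  refine (dominates_iff_finset _ _).2
    ⟨K * (B * R) + C * (2 * B * R * (K' * B)), by positivity, fun s c => ?_⟩
  simp only [← map_smul, ← map_sum]
  refine norm_ofFinsupp_le fun k q hq0 hq => ?_
  rw [jamesRep_sum]
  let σ : ℕ → ℕ → ℝ := fun i j => ∑ l ∈ Finset.Ico (q i) (q (i + 1)), w j l
  let own : ℕ → Finset ℕ := fun j =>
    (Finset.range k).filter fun i => q i ∈ Finset.Ico (p j) (p (j + 1))
  let other : ℕ → Finset ℕ := fun j =>
    (Finset.range k).filter fun i => ¬ q i ∈ Finset.Ico (p j) (p (j + 1))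
  let cut : ℕ → ℕ → Prop := fun j i => i < k ∧ q i < p j ∧ p j < q (i + 1) ∧ q (i + 1) < p (j + 1)
  have hsplit : ∀ j, jamesRep e k q (w j)
      = ∑ i ∈ own j, σ i j • e (q i) + ∑ i ∈ other j, σ i j • e (q i) := fun j =>
    (Finset.sum_filter_add_sum_filter_not _ _ _).symm
  have hzero : ∀ j, ∀ i ∈ other j, ¬ cut j i → σ i j = 0 := by
    intro j i hi hcut
    obtain ⟨hik, hi⟩ := Finset.mem_filter.1 hi
    rw [Finset.mem_range] at hik
    rw [Finset.mem_Ico, not_and_or, not_le, not_lt] at hi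
    rcases hi with hi | hi
    · rcases le_or_gt (q (i + 1)) (p j) with h | h
      · exact Finset.sum_eq_zero fun l hl => hlow j l ((Finset.mem_Ico.1 hl).2.trans_le h)
      · have h' : p (j + 1) ≤ q (i + 1) := by
          by_contra h'
          exact hcut ⟨hik, hi, h, not_le.1 h'⟩
        rw [← hsum j]
        refine (Finset.sum_subset (Finset.Ico_subset_Ico hi.le h') fun l _ hl => ?_).symm
        rw [Finset.mem_Ico, not_and_or, not_le, not_lt] at hl
        exact hl.elim (hlow j l) (hhigh j l)
    · exact Finset.sum_eq_zero fun l hl => hhigh j l (hi.trans (Finset.mem_Ico.1 hl).1)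
  have hcut_lt : ∀ j j' i i', cut j i → cut j' i' → j < j' → i < i' := by
    intro j j' i i' h h' hjj
    have h1 := hp.monotone (Nat.succ_le_of_lt hjj)
    have h2 : q (i + 1) < q (i' + 1) := h.2.2.2.trans_le (h1.trans h'.2.2.1.le)
    have := hq.lt_iff_lt.1 h2
    omega
  have hcut_unique : ∀ j i i', cut j i → cut j i' → i = i' := by
    intro j i i' h h'
    have h1 := hq.lt_iff_lt.1 (h.2.1.trans h'.2.2.1)
    have h2 := hq.lt_iff_lt.1 (h'.2.1.trans h.2.2.1)
    omega
  let ι : ℕ → ℕ := fun j => if h : ∃ i, cut j i then h.choose else 0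
  have hι : ∀ j, (∃ i, cut j i) → cut j (ι j) := fun j h => by
    simp only [ι, dif_pos h]; exact h.choose_spec
  have hother : ∀ j, ∑ i ∈ other j, σ i j • e (q i)
      = if ∃ i, cut j i then σ (ι j) j • e (q (ι j)) else 0 := by
    intro j
    split_ifs with h
    · have hc := hι j h
      refine Finset.sum_eq_single_of_mem (ι j) ?_ fun i hi hne => ?_
      · refine Finset.mem_filter.2 ⟨Finset.mem_range.2 hc.1, fun hm => ?_⟩
        exact (Finset.mem_Ico.1 hm).1.not_gt hc.2.1
      · rw [hzero j i hi fun hi' => hne (hcut_unique j _ _ hi' hc), zero_smul]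
    · exact Finset.sum_eq_zero fun i hi => by rw [hzero j i hi fun hi' => h ⟨i, hi'⟩, zero_smul]
  have hσ : ∀ j i, cut j i → |σ i j| ≤ R := by
    intro j i h
    -- As `w j` vanishes below `p j` and `q i < p j`, the cut sum is an initial sum.
    have : σ i j = ∑ l ∈ Finset.range (q (i + 1)), w j l := by
      rw [Finset.range_eq_Ico]
      refine Finset.sum_subset (Finset.Ico_subset_Ico_left (Nat.zero_le _)) fun l hl hl' => ?_
      rw [Finset.mem_Ico] at hl hl'
      exact hlow j l (by have := h.2.1; omega)
    rw [this]
    exact (abs_sum_range_le hnorm _ _).trans (hR j)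
  simp only [hsplit, smul_add, Finset.sum_add_distrib]
  rw [add_mul]
  refine (norm_add_le _ _).trans (add_le_add ?_ ?_)
  · refine huniform (B * R) _ (fun j => ?_) (fun j => ?_) s c
    · refine Submodule.sum_mem _ fun i hi => Submodule.smul_mem _ _ (Submodule.subset_span ?_)
      exact ⟨q i, by simpa using (Finset.mem_filter.1 hi).2, rfl⟩
    · have h1 : ∑ i ∈ own j, σ i j • e (q i) = ∑ l ∈ (own j).image q,
          (σ (Function.invFun q l) j) • e l := by
        rw [Finset.sum_image fun x _ y _ h => hq.injective h]
        simp [Function.leftInverse_invFun hq.injective _]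
      have h2 : jamesRep e k q (w j) = ∑ l ∈ (Finset.range k).image q,
          (σ (Function.invFun q l) j) • e l := by
        rw [Finset.sum_image fun x _ y _ h => hq.injective h]
        simp [Function.leftInverse_invFun hq.injective _, jamesRep, σ]
      rw [h1]
      refine (hB.2 _ _ _ (Finset.image_subset_image (Finset.filter_subset _ _))).trans ?_
      rw [← h2]
      exact mul_le_mul_of_nonneg_left ((norm_jamesRep_le e _ k hq0 hq).trans (hR j)) hB0
  · simp only [hother, smul_ite, smul_zero]
    rw [← Finset.sum_filter]
    set S := s.filter fun j => ∃ i, cut j i with hS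
    have hSι : ∀ j ∈ S, cut j (ι j) := fun j hj => hι j (Finset.mem_filter.1 hj).2
    simp only [smul_smul]
    -- Right dominance moves `e (q (ι j))` to `e (p j)`: the cutting intervals increase with `j`, so
    -- `p j < q (ι j + 1) ≤ q (ι j')` for `j < j'`.
    have h1 := hrd S (fun j => q (ι j)) p (fun j hj => (hSι j hj).2.1.le)
      (fun j hj j' hj' hjj => (hSι j hj).2.2.1.trans_le
        (hq.monotone (hcut_lt j j' _ _ (hSι j hj) (hSι j' hj') hjj))) (fun j => c j * σ (ι j) j)
    have h2 : ‖∑ j ∈ S, (c j * σ (ι j) j) • e j‖ ≤ 2 * B * R * ‖∑ j ∈ S, c j • e j‖ := by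
      simp only [mul_comm (c _)]
      exact hB.norm_sum_mul_le S _ c fun j hj => hσ j _ (hSι j hj)
    have h3 := hB.2 s S c (Finset.filter_subset _ _)
    calc _ ≤ _ := h1
      _ ≤ C * (K' * ‖∑ j ∈ S, (c j * σ (ι j) j) • e j‖) :=
          mul_le_mul_of_nonneg_left (hsub S _) hC
      _ ≤ C * (K' * (2 * B * R * (B * ‖∑ j ∈ s, c j • e j‖))) := by
          gcongr
          exact h2.trans (by gcongr)
      _ = _ := by ring

/-- The part of a sequence living on `[p, ∞)`, corrected at `p` to have total sum zero. -/
noncomputable def zeroSumTail (e : ℕ → X) (p : ℕ) : JamesSpace e →L[ℝ] JamesSpace e :=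
  ContinuousLinearMap.id ℝ _
    - ∑ l ∈ Finset.range p, (coord e l).smulRight (ofFinsupp e (Finsupp.single l 1))
    - (total e - ∑ l ∈ Finset.range p, coord e l).smulRight (ofFinsupp e (Finsupp.single p 1))

theorem zeroSumTail_apply (p : ℕ) (x : JamesSpace e) : zeroSumTail e p x = x
    - ∑ l ∈ Finset.range p, coord e l x • ofFinsupp e (Finsupp.single l 1)
    - (total e x - ∑ l ∈ Finset.range p, coord e l x) • ofFinsupp e (Finsupp.single p 1) := by
  simp [zeroSumTail]

theorem zeroSumTail_ofFinsupp (hnorm : IsNormalizedSeq e) (p : ℕ) (a : ℕ →₀ ℝ) :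
    ∃ w : ℕ →₀ ℝ, (w.sum fun _ t => t) = 0 ∧ (∀ l < p, w l = 0) ∧
      zeroSumTail e p (ofFinsupp e a) = ofFinsupp e w := by
  refine ⟨a - ∑ l ∈ Finset.range p, a l • Finsupp.single l 1
    - ((a.sum fun _ t => t) - ∑ l ∈ Finset.range p, a l) • Finsupp.single p 1, ?_, ?_, ?_⟩
  · have h : ∀ a : ℕ →₀ ℝ, (a.sum fun _ t => t) = Finsupp.linearCombination ℝ (fun _ => (1 : ℝ)) a :=
      fun a => by simp [Finsupp.linearCombination_apply]
    simp only [h, map_sub, map_sum, map_smul, Finsupp.linearCombination_single]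
    simp
  · intro l hl
    simp [Finsupp.single_apply, hl, hl.ne']
  · rw [zeroSumTail_apply]
    simp only [coord_ofFinsupp hnorm, total_ofFinsupp hnorm, map_sub, map_sum, map_smul]

/-- `zeroSumTail e p` changes `y b` by finitely many vectors whose coefficients tend to 0, and it
keeps finitely supported vectors finitely supported, so density finishes. -/
theorem eventually_near_zero_sum (hnorm : IsNormalizedSeq e) {y : ℕ → JamesSpace e}
    (hc : ∀ n, Tendsto (fun j => coord e n (y j)) atTop (𝓝 0))
    (ht : Tendsto (fun j => total e (y j)) atTop (𝓝 0)) (p : ℕ) {ε : ℝ} (hε : 0 < ε) :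
    ∀ᶠ b in atTop, ∃ w : ℕ →₀ ℝ, (w.sum fun _ t => t) = 0 ∧ (∀ l < p, w l = 0) ∧
      ‖y b - ofFinsupp e w‖ ≤ ε := by
  have h1 : Tendsto (fun b => y b - zeroSumTail e p (y b)) atTop (𝓝 0) := by
    have hs : Tendsto (fun b => ∑ l ∈ Finset.range p, coord e l (y b)) atTop (𝓝 0) := by
      simpa using tendsto_finsetSum (Finset.range p) fun l _ => hc l
    have hs' : Tendsto (fun b => ∑ l ∈ Finset.range p,
        coord e l (y b) • ofFinsupp e (Finsupp.single l 1)) atTop (𝓝 0) := by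
      simpa using tendsto_finsetSum (Finset.range p) fun l _ => (hc l).smul_const
        (ofFinsupp e (Finsupp.single l 1))
    have := hs'.add ((ht.sub hs).smul_const (ofFinsupp e (Finsupp.single p 1)))
    simp only [sub_zero, zero_smul, add_zero] at this
    refine this.congr fun b => ?_
    rw [zeroSumTail_apply]
    abel
  have h2 := (tendsto_zero_iff_norm_tendsto_zero.1 h1).eventually (gt_mem_nhds (half_pos hε))
  filter_upwards [h2] with b hb
  obtain ⟨a, ha⟩ := (denseRange_ofFinsupp e).exists_mem_open
    (s := {x | ‖zeroSumTail e p (y b) - zeroSumTail e p x‖ < ε / 2})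
    (isOpen_lt (by fun_prop) continuous_const) ⟨y b, by simpa using half_pos hε⟩
  obtain ⟨w, hw1, hw2, hw3⟩ := zeroSumTail_ofFinsupp hnorm p a
  refine ⟨w, hw1, hw2, ?_⟩
  rw [← hw3]
  have := norm_add_le (y b - zeroSumTail e p (y b))
    (zeroSumTail e p (y b) - zeroSumTail e p (ofFinsupp e a))
  rw [sub_add_sub_cancel] at this
  have ha' : ‖zeroSumTail e p (y b) - zeroSumTail e p (ofFinsupp e a)‖ < ε / 2 := ha
  linarith

/-- A bounded sequence whose coordinates and total sums tend to zero has a subsequence dominated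
by `(e_i)`. -/
theorem exists_dominated_subseq [CompleteSpace X] {B : ℝ} (hB : IsSuppressionBound e B)
    (hnorm : IsNormalizedSeq e) (hright : IsRightDominant e)
    (hblock : ∀ w : ℕ → X, IsBlockBasis e w → IsNormalizedSeq w → Dominates e w)
    {y : ℕ → JamesSpace e} {M : ℝ} (hM : ∀ j, ‖y j‖ ≤ M)
    (hc : ∀ n, Tendsto (fun j => coord e n (y j)) atTop (𝓝 0))
    (ht : Tendsto (fun j => total e (y j)) atTop (𝓝 0)) :
    ∃ φ : ℕ → ℕ, StrictMono φ ∧ Dominates e (y ∘ φ) := by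
  -- Gliding hump: a state holds the last index chosen in `y` and the start of the next block.
  have step : ∀ (n : ℕ) (st : ℕ × ℕ), ∃ (st' : ℕ × ℕ) (w : ℕ →₀ ℝ), st.1 < st'.1 ∧ st.2 < st'.2 ∧
      (∀ l < st.2, w l = 0) ∧ (∀ l, st'.2 ≤ l → w l = 0) ∧
      ∑ l ∈ Finset.Ico st.2 st'.2, w l = 0 ∧
      ‖y st'.1 - ofFinsupp e w‖ ≤ (1 / 2 : ℝ) ^ n := by
    rintro n ⟨b, p⟩
    obtain ⟨b', ⟨w, hw1, hw2, hw3⟩, hb⟩ := ((eventually_near_zero_sum hnorm hc ht p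
      (ε := (1 / 2 : ℝ) ^ n) (by positivity)).and (eventually_gt_atTop b)).exists
    have hhigh : ∀ l, max (p + 1) (w.support.sup id + 1) ≤ l → w l = 0 := by
      intro l hl
      by_contra h
      have : l ≤ w.support.sup id := Finset.le_sup (f := id) (Finsupp.mem_support_iff.2 h)
      have := le_max_right (p + 1) (w.support.sup id + 1)
      omega
    refine ⟨(b', max (p + 1) (w.support.sup id + 1)), w, hb, lt_max_of_lt_left p.lt_succ_self, hw2,
      hhigh, ?_, hw3⟩
    rw [← hw1]
    refine (Finsupp.sum_of_support_subset w (fun l hl => ?_) (fun _ t => t) (by simp)).symm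
    rw [Finsupp.mem_support_iff] at hl
    rw [Finset.mem_Ico]
    exact ⟨not_lt.1 fun h => hl (hw2 l h), not_le.1 fun h => hl (hhigh l h)⟩
  choose F W h1 h2 h3 h4 h5 h6 using step
  let st : ℕ → ℕ × ℕ := fun n => Nat.rec (0, 0) F n
  have hst : ∀ n, st (n + 1) = F n (st n) := fun n => rfl
  refine ⟨fun n => (st (n + 1)).1, strictMono_nat_of_lt_succ fun n => h1 (n + 1) (st (n + 1)), ?_⟩
  refine dominates_of_perturbation hB hnorm (z := fun n => ofFinsupp e (W n (st n)))
    (fun n => h6 n (st n)) ?_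
  refine dominates_zero_sum_blocks hB hnorm hright hblock (p := fun n => (st n).2)
    (strictMono_nat_of_lt_succ fun n => h2 n (st n)) (fun n => h3 n (st n)) (fun n => h4 n (st n))
    (fun n => h5 n (st n)) (R := M + 1) fun n => ?_
  have hn := h6 n (st n)
  have hle : (1 / 2 : ℝ) ^ n ≤ 1 := pow_le_one₀ (by norm_num) (by norm_num)
  have := norm_sub_norm_le (ofFinsupp e (W n (st n))) (y (st (n + 1)).1)
  rw [norm_sub_rev] at this
  have := hM (st (n + 1)).1
  rw [← hst] at hn
  linarith

end JamesSpace

end James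

/-! ### Subsequence extraction, weak nullity and pairings -/

section Operators

variable {X Y Z : Type*} [NormedAddCommGroup X] [NormedSpace ℝ X]
  [NormedAddCommGroup Y] [NormedSpace ℝ Y] [NormedAddCommGroup Z] [NormedSpace ℝ Z]

theorem exists_separated_of_not_isCompactOperator [CompleteSpace Z] (T : Y →L[ℝ] Z)
    (hT : ¬ IsCompactOperator T) : ∃ δ : ℝ, 0 < δ ∧ ∃ x : ℕ → Y, (∀ n, ‖x n‖ ≤ 1) ∧
      ∀ m n, m < n → δ ≤ ‖T (x n) - T (x m)‖ := by
  have h1 : ¬ TotallyBounded (T '' Metric.closedBall 0 1) := by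
    intro h
    refine hT ((isCompactOperator_iff_isCompact_closure_image_closedBall (T : Y →ₗ[ℝ] Z)
      one_pos).2 ?_)
    exact (totallyBounded_closure.2 h).isCompact_of_isClosed isClosed_closure
  rw [Metric.totallyBounded_iff] at h1
  push Not at h1
  obtain ⟨δ, hδ, h⟩ := h1
  obtain ⟨x, hx, hsep⟩ := exists_seq_of_forall_finset_exists (fun x : Y => ‖x‖ ≤ 1)
    (fun x y => δ ≤ ‖T y - T x‖) (fun s _ => by
      classical
      obtain ⟨_, ⟨y, hy, rfl⟩, hy'⟩ := Set.not_subset.1 (h _ (s.image T).finite_toSet)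
      refine ⟨y, by simpa using hy, fun x hx => ?_⟩
      by_contra hlt
      refine hy' (Set.mem_iUnion₂.2 ⟨T x, by simpa using ⟨x, hx, rfl⟩, ?_⟩)
      rw [Metric.mem_ball, dist_eq_norm]
      exact not_le.1 hlt)
  exact ⟨δ, hδ, x, hx, hsep⟩

/-- The values lie in a countable product of compact intervals, which is sequentially compact. -/
theorem exists_subseq_tendsto_functionals {ι : Type*} [Countable ι] (g : ι → StrongDual ℝ Y)
    {x : ℕ → Y} {M : ℝ} (hx : ∀ n, ‖x n‖ ≤ M) :
    ∃ φ : ℕ → ℕ, StrictMono φ ∧ ∀ i, ∃ a, Tendsto (fun k => g i (x (φ k))) atTop (𝓝 a) := by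
  have hK : IsCompact (Set.univ.pi fun i => Metric.closedBall (0 : ℝ) (‖g i‖ * M)) :=
    isCompact_univ_pi fun i => isCompact_closedBall _ _
  obtain ⟨a, -, φ, hφ, ha⟩ := hK.tendsto_subseq (x := fun n i => g i (x n)) (fun n i _ => by
    rw [mem_closedBall_zero_iff]
    exact (g i).le_opNorm_of_le (hx n))
  exact ⟨φ, hφ, fun i => ⟨a i, (tendsto_pi_nhds.1 ha) i⟩⟩

theorem exists_strictMono_of_eventually {Q : ℕ → ℕ → ℕ → Prop}
    (h : ∀ a j, ∀ᶠ b in atTop, Q a j b) :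
    ∃ φ : ℕ → ℕ, StrictMono φ ∧ ∀ i j, i < j → Q (φ i) j (φ j) := by
  have step : ∀ j m : ℕ, ∃ b, m < b ∧ ∀ a ≤ m, Q a (j + 1) b := by
    intro j m
    have h1 : ∀ᶠ b in atTop, ∀ a ∈ Finset.range (m + 1), Q a (j + 1) b :=
      (Finset.eventually_all _).2 fun a _ => h a (j + 1)
    obtain ⟨b, hb, hmb⟩ := (h1.and (eventually_gt_atTop m)).exists
    exact ⟨b, hmb, fun a ha => hb a (Finset.mem_range_succ_iff.2 ha)⟩
  choose F hF1 hF2 using step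
  let φ : ℕ → ℕ := fun n => Nat.rec 0 F n
  have hφ : StrictMono φ := strictMono_nat_of_lt_succ fun n => hF1 n (φ n)
  refine ⟨φ, hφ, fun i j hij => ?_⟩
  obtain ⟨j, rfl⟩ : ∃ k, j = k + 1 := ⟨j - 1, by omega⟩
  exact hF2 j (φ j) _ (hφ.monotone (Nat.le_of_lt_succ hij))

variable {e : ℕ → X}

theorem dominates_coe_iff {E : Submodule ℝ Y} {y : ℕ → E} :
    Dominates e (fun k => (y k : Y)) ↔ Dominates e y := by
  simp only [dominates_iff_finset, ← Submodule.coe_norm, ← Submodule.coe_smul,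
    ← AddSubmonoidClass.coe_finsetSum]

/-- If `(e_i)` does not dominate some bounded sequence, then every sequence that it dominates
is weakly null. -/
theorem tendsto_zero_of_dominates {B : ℝ} (hB : IsSuppressionBound e B)
    (hnorm : IsNormalizedSeq e)
    (hblock : ∀ w : ℕ → X, IsBlockBasis e w → IsNormalizedSeq w → Dominates e w)
    {f : ℕ → Z} {M : ℝ} (hf : ∀ i, ‖f i‖ ≤ M) (hnd : ¬ Dominates e f) {y : ℕ → Y}
    (hy : Dominates e y) (g : StrongDual ℝ Y) : Tendsto (fun j => g (y j)) atTop (𝓝 0) := by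
  by_contra hlim
  obtain ⟨ε, hε, hfreq⟩ : ∃ ε : ℝ, 0 < ε ∧ ∃ᶠ j in atTop, ε ≤ |g (y j)| := by
    rw [Metric.tendsto_nhds] at hlim
    push Not at hlim
    obtain ⟨ε, hε, h⟩ := hlim
    refine ⟨ε, hε, ?_⟩
    simpa using h
  obtain ⟨φ, hφ, hφε⟩ := extraction_of_frequently_atTop hfreq
  obtain ⟨K, hK, hdom⟩ := (dominates_iff_finset _ _).1
    ((hy.subseq hnorm hblock hφ).clm_comp g)
  have hM : 0 ≤ M := (norm_nonneg _).trans (hf 0)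
  have hB0 := hB.1
  refine hnd ((dominates_iff_finset _ _).2 ⟨M * (K * (2 * B * ε⁻¹)), by positivity, fun s c => ?_⟩)
  have h1 : ‖∑ i ∈ s, c i • f i‖ ≤ M * ∑ i ∈ s, |c i| := by
    rw [Finset.mul_sum]
    refine norm_sum_le_of_le _ fun i _ => ?_
    rw [norm_smul, mul_comm, Real.norm_eq_abs]
    exact mul_le_mul_of_nonneg_right (hf i) (abs_nonneg _)
  -- Bounded multipliers with `t i * c i * g (y (φ i)) = |c i|`: unconditionality and domination of
  -- the scalars `g (y (φ i))` then bound ∑|c_i|.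
  let t : ℕ → ℝ := fun i => SignType.sign (c i) * (g (y (φ i)))⁻¹
  have ht : ∀ i ∈ s, |t i| ≤ ε⁻¹ := by
    intro i _
    rw [abs_mul, abs_inv]
    have h1 : |((SignType.sign (c i) : SignType) : ℝ)| ≤ 1 := by
      rcases SignType.sign (c i) with _ | _ | _ <;> simp
    calc _ ≤ 1 * |g (y (φ i))|⁻¹ := mul_le_mul_of_nonneg_right h1 (by positivity)
      _ ≤ ε⁻¹ := by rw [one_mul]; exact inv_anti₀ hε (hφε i)
  have h2 : ∑ i ∈ s, |c i| = ∑ i ∈ s, (t i * c i) • g (y (φ i)) := by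
    refine Finset.sum_congr rfl fun i _ => ?_
    have hne : g (y (φ i)) ≠ 0 := fun h0 => by
      have := hφε i
      rw [h0, abs_zero] at this
      linarith
    have := sign_mul_self (c i)
    simp only [t, smul_eq_mul]
    field_simp
    rw [mul_comm, mul_comm] at this
    linarith
  have h3 : ∑ i ∈ s, |c i| ≤ K * (2 * B * ε⁻¹ * ‖∑ i ∈ s, c i • e i‖) := by
    rw [h2]
    exact (Real.le_norm_self _).trans ((hdom s _).trans
      (mul_le_mul_of_nonneg_left (hB.norm_sum_mul_le s t c ht) hK))
  refine h1.trans ((mul_le_mul_of_nonneg_left h3 hM).trans_eq ?_)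
  ring

theorem norm_sum_biorthogonal_le (he : IsBasicSequence e) {B : ℝ} (hB : IsSuppressionBound e B)
    (s : Finset ℕ) (x : closedSpan e) :
    ‖∑ i ∈ s, biorthogonal he i x • e i‖ ≤ B * ‖x‖ := by
  have h1 : Tendsto (fun n => B * ‖he.choose.proj n x‖) atTop (𝓝 (B * ‖x‖)) :=
    (he.choose.tendsto_proj x).norm.const_mul B
  refine ge_of_tendsto h1 ?_
  filter_upwards [eventually_ge_atTop (s.sup id + 1)] with n hn
  have hs : s ⊆ Finset.range n := fun i hi => by
    have : i ≤ s.sup id := Finset.le_sup (f := id) hi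
    exact Finset.mem_range.2 (by omega)
  have h2 : ((he.choose.proj n x : closedSpan e) : X)
      = ∑ i ∈ Finset.range n, biorthogonal he i x • e i := by
    rw [SchauderBasis.proj_apply, AddSubmonoidClass.coe_finsetSum]
    exact Finset.sum_congr rfl fun i _ => by
      rw [Submodule.coe_smul, he.choose_spec i]; rfl
  rw [Submodule.coe_norm, h2]
  exact hB.2 _ _ _ hs

theorem norm_biorthogonal_le (he : IsBasicSequence e) (hnorm : IsNormalizedSeq e) {B : ℝ}
    (hB : IsSuppressionBound e B) (i : ℕ) : ‖biorthogonal he i‖ ≤ B := by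
  refine ContinuousLinearMap.opNorm_le_bound _ hB.1 fun x => ?_
  simpa [norm_smul, hnorm i] using norm_sum_biorthogonal_le he hB {i} x

/-- The value of ∑ c_i e'_i at x is the pairing of c with the coordinates of x, whose partial sums
have norm at most `B * ‖x‖`. -/
theorem dominates_biorthogonal_of_pairing (he : IsBasicSequence e) {B : ℝ}
    (hB : IsSuppressionBound e B) {K : ℝ} (hK : 0 ≤ K)
    (h : ∀ (s : Finset ℕ) (c d : ℕ → ℝ), |∑ i ∈ s, c i * d i|
      ≤ K * ‖∑ i ∈ s, c i • e i‖ * ‖∑ i ∈ s, d i • e i‖) :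
    Dominates e (biorthogonal he) := by
  have hB0 := hB.1
  refine (dominates_iff_finset _ _).2 ⟨K * B, by positivity, fun s c => ?_⟩
  refine ContinuousLinearMap.opNorm_le_bound _ (by positivity) fun x => ?_
  have h1 : (∑ i ∈ s, c i • biorthogonal he i) x = ∑ i ∈ s, c i * biorthogonal he i x := by
    simp [_root_.sum_apply]
  rw [h1, Real.norm_eq_abs]
  refine (h s c _).trans ((mul_le_mul_of_nonneg_left (norm_sum_biorthogonal_le he hB s x)
    (by positivity)).trans_eq (by ring))

/-- Evaluating ∑ c_i η_i at ∑ d_j v_j gives the diagonal sum plus an error that is summable by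
`hoff`. The diagonal entries are at least δ, so unconditionality allows dividing d_i by them. -/
theorem exists_pairing_bound {B : ℝ} (hB : IsSuppressionBound e B) (hnorm : IsNormalizedSeq e)
    {η : ℕ → StrongDual ℝ Y} {v : ℕ → Y} (hη : Dominates e η) (hv : Dominates e v) {δ : ℝ}
    (hδ : 0 < δ) (hdiag : ∀ i, δ ≤ η i (v i))
    (hoff : ∀ i j, i ≠ j → |η i (v j)| ≤ (1 / 2 : ℝ) ^ i * (1 / 2 : ℝ) ^ j) :
    ∃ K, 0 ≤ K ∧ ∀ (s : Finset ℕ) (c d : ℕ → ℝ), |∑ i ∈ s, c i * d i|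
      ≤ K * ‖∑ i ∈ s, c i • e i‖ * ‖∑ i ∈ s, d i • e i‖ := by
  obtain ⟨K, hK, hη⟩ := (dominates_iff_finset _ _).1 hη
  obtain ⟨K', hK', hv⟩ := (dominates_iff_finset _ _).1 hv
  have hB0 := hB.1
  have main : ∀ (s : Finset ℕ) (c d : ℕ → ℝ), |∑ i ∈ s, c i * (d i * η i (v i))|
      ≤ (K * K' + B * B * 4) * ‖∑ i ∈ s, c i • e i‖ * ‖∑ i ∈ s, d i • e i‖ := by
    intro s c d
    set r := ‖∑ i ∈ s, c i • e i‖ with hr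
    set r' := ‖∑ i ∈ s, d i • e i‖ with hr'
    let off : ℝ := ∑ i ∈ s, ∑ j ∈ s, if i = j then 0 else c i * (d j * η i (v j))
    have h1 : (∑ i ∈ s, c i • η i) (∑ j ∈ s, d j • v j)
        = ∑ i ∈ s, c i * (d i * η i (v i)) + off := by
      rw [_root_.sum_apply, ← Finset.sum_add_distrib]
      refine Finset.sum_congr rfl fun i hi => ?_
      rw [map_sum, ← Finset.add_sum_erase _ _ hi, ← Finset.add_sum_erase _ _ hi]
      simp only [_root_.smul_apply, map_smul, smul_eq_mul, if_true, zero_add]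
      congr 1
      · ring
      refine Finset.sum_congr rfl fun j hj => ?_
      rw [if_neg (Finset.ne_of_mem_erase hj).symm, mul_left_comm]
    have h2 : |(∑ i ∈ s, c i • η i) (∑ j ∈ s, d j • v j)| ≤ K * r * (K' * r') :=
      (ContinuousLinearMap.le_opNorm _ _).trans
        (mul_le_mul (hη s c) (hv s d) (norm_nonneg _) (by positivity))
    have hgeo : ∑ i ∈ s, (1 / 2 : ℝ) ^ i ≤ 2 :=
      (summable_geometric_two.sum_le_tsum _ fun _ _ => by positivity).trans_eq tsum_geometric_two
    have h3 : |off| ≤ B * r * (B * r') * 4 := by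
      calc |off| ≤ ∑ i ∈ s, ∑ j ∈ s,
            B * r * (B * r') * ((1 / 2 : ℝ) ^ i * (1 / 2 : ℝ) ^ j) := by
            refine (Finset.abs_sum_le_sum_abs _ _).trans (Finset.sum_le_sum fun i hi => ?_)
            refine (Finset.abs_sum_le_sum_abs _ _).trans (Finset.sum_le_sum fun j hj => ?_)
            split_ifs with hij
            · rw [abs_zero]; positivity
            · rw [abs_mul, abs_mul, ← mul_assoc]
              have hci := hB.abs_coeff_le hnorm s c hi
              have hdj := hB.abs_coeff_le hnorm s d hj
              have := hoff i j hij
              gcongr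
        _ = B * r * (B * r') * ((∑ i ∈ s, (1 / 2 : ℝ) ^ i) * ∑ j ∈ s, (1 / 2 : ℝ) ^ j) := by
            rw [Finset.sum_mul_sum, Finset.mul_sum]
            simp only [Finset.mul_sum]
        _ ≤ B * r * (B * r') * (2 * 2) := by gcongr
        _ = _ := by ring
    have h4 : ∑ i ∈ s, c i * (d i * η i (v i))
        = (∑ i ∈ s, c i • η i) (∑ j ∈ s, d j • v j) - off := by rw [h1]; ring
    rw [h4]
    refine (abs_sub _ _).trans ((add_le_add h2 h3).trans_eq ?_)
    ring
  refine ⟨(K * K' + B * B * 4) * (2 * B * δ⁻¹), by positivity, fun s c d => ?_⟩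
  have h1 := main s c fun i => (η i (v i))⁻¹ * d i
  have h2 : ∑ i ∈ s, c i * ((η i (v i))⁻¹ * d i * η i (v i)) = ∑ i ∈ s, c i * d i := by
    refine Finset.sum_congr rfl fun i _ => ?_
    have : η i (v i) ≠ 0 := (hδ.trans_le (hdiag i)).ne'
    field_simp
  rw [h2] at h1
  have h3 := hB.norm_sum_mul_le s (fun i => (η i (v i))⁻¹) d (R := δ⁻¹) fun i _ => by
    rw [abs_inv, abs_of_pos (hδ.trans_le (hdiag i))]
    exact inv_anti₀ hδ (hdiag i)
  refine h1.trans ((mul_le_mul_of_nonneg_left h3 (by positivity)).trans_eq (by ring))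

theorem exists_norm_le_one_half_le {g : StrongDual ℝ Y} {δ : ℝ} (hδ : 0 < δ) (hg : δ ≤ ‖g‖) :
    ∃ z, ‖z‖ ≤ 1 ∧ δ / 2 ≤ g z := by
  obtain ⟨z, hz, hgz⟩ := g.exists_lt_apply_of_lt_opNorm ((half_lt_self hδ).trans_le hg)
  rcases le_total 0 (g z) with h | h
  · exact ⟨z, hz.le, by rw [Real.norm_of_nonneg h] at hgz; exact hgz.le⟩
  · exact ⟨-z, by rw [norm_neg]; exact hz.le, by
      rw [Real.norm_of_nonpos h] at hgz; rw [map_neg]; exact hgz.le⟩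

/-! ### Compactness when (e_i) does not dominate (e'_i) -/

namespace JamesSpace

theorem exists_subseq_tendsto_coord {x : ℕ → JamesSpace e} {M : ℝ} (hx : ∀ n, ‖x n‖ ≤ M) :
    ∃ φ : ℕ → ℕ, StrictMono φ ∧
      (∀ n, ∃ a, Tendsto (fun k => coord e n (x (φ k))) atTop (𝓝 a)) ∧
      ∃ a, Tendsto (fun k => total e (x (φ k))) atTop (𝓝 a) := by
  obtain ⟨φ, hφ, h⟩ := exists_subseq_tendsto_functionals
    (fun i : Option ℕ => i.elim (total e) (coord e)) hx
  exact ⟨φ, hφ, fun n => h (some n), h none⟩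

/-- Consecutive differences of a bounded sequence with convergent coordinates and total sums
have a subsequence dominated by `(e_i)`. -/
theorem exists_dominated_differences [CompleteSpace X] {B : ℝ} (hB : IsSuppressionBound e B)
    (hnorm : IsNormalizedSeq e) (hright : IsRightDominant e)
    (hblock : ∀ w : ℕ → X, IsBlockBasis e w → IsNormalizedSeq w → Dominates e w)
    {x : ℕ → JamesSpace e} {M : ℝ} (hM : ∀ j, ‖x j‖ ≤ M)
    (hc : ∀ n, ∃ a, Tendsto (fun j => coord e n (x j)) atTop (𝓝 a))
    (ht : ∃ a, Tendsto (fun j => total e (x j)) atTop (𝓝 a)) :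
    ∃ ψ : ℕ → ℕ, StrictMono ψ ∧ Dominates e fun k => x (ψ k + 1) - x (ψ k) := by
  have key : ∀ g : StrongDual ℝ (JamesSpace e), (∃ a, Tendsto (fun j => g (x j)) atTop (𝓝 a)) →
      Tendsto (fun j => g (x (j + 1) - x j)) atTop (𝓝 0) := by
    rintro g ⟨a, ha⟩
    simpa using (ha.comp (tendsto_add_atTop_nat 1)).sub ha
  exact exists_dominated_subseq hB hnorm hright hblock (y := fun j => x (j + 1) - x j)
    (M := M + M) (fun j => (norm_sub_le _ _).trans (add_le_add (hM _) (hM _)))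
    (fun n => key _ (hc n)) (key _ ht)

theorem isCompactOperator_of_not_dominates [CompleteSpace X] (he : IsBasicSequence e)
    (hnorm : IsNormalizedSeq e) (hright : IsRightDominant e)
    (hblock : ∀ w : ℕ → X, IsBlockBasis e w → IsNormalizedSeq w → Dominates e w)
    (hnd : ¬ Dominates e (biorthogonal he)) (E : Submodule ℝ (JamesSpace e))
    (T : E →L[ℝ] StrongDual ℝ (JamesSpace e)) : IsCompactOperator T := by
  obtain ⟨B, hB⟩ := hright.1.exists_suppressionBound
  have hnull : ∀ {W : Type} [NormedAddCommGroup W] [NormedSpace ℝ W] {y : ℕ → W},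
      Dominates e y → ∀ g : StrongDual ℝ W, Tendsto (fun j => g (y j)) atTop (𝓝 0) :=
    fun hy g => tendsto_zero_of_dominates hB hnorm hblock (norm_biorthogonal_le he hnorm hB) hnd
      hy g
  by_contra hT
  obtain ⟨δ, hδ, x, hx, hsep⟩ := exists_separated_of_not_isCompactOperator T hT
  obtain ⟨φ, hφ, hφc, hφt⟩ := exists_subseq_tendsto_coord (x := fun n => (x n : JamesSpace e)) hx
  obtain ⟨ψ, hψ, hdom⟩ := exists_dominated_differences hB hnorm hright hblock
    (x := fun n => (x (φ n) : JamesSpace e)) (fun n => hx _) hφc hφt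
  let η : ℕ → StrongDual ℝ (JamesSpace e) := fun k => T (x (φ (ψ k + 1)) - x (φ (ψ k)))
  have hη : Dominates e η := by
    refine Dominates.clm_comp (dominates_coe_iff.1 ?_) T
    simpa using hdom
  have hηδ : ∀ k, δ ≤ ‖η k‖ := fun k => by
    simp only [η, map_sub]
    exact hsep _ _ (hφ (Nat.lt_succ_self _))
  choose z hz hηz using fun k => exists_norm_le_one_half_le hδ (hηδ k)
  obtain ⟨θ, hθ, hθc, hθt⟩ := exists_subseq_tendsto_coord hz
  have hηθ : Dominates e (η ∘ θ) := hη.subseq hnorm hblock hθ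
  have hηnull : ∀ {η : ℕ → StrongDual ℝ (JamesSpace e)}, Dominates e η → ∀ z,
      Tendsto (fun k => η k z) atTop (𝓝 0) := fun hη z =>
    hnull hη (ContinuousLinearMap.apply ℝ ℝ z)
  -- Later functionals nearly vanish on earlier vectors, so subtracting the earlier vector costs the
  -- diagonal value δ/2 at most δ/4.
  obtain ⟨α, hα, hαδ⟩ := exists_strictMono_of_eventually
    (Q := fun a _ b => |η (θ b) (z (θ a))| < δ / 4) (fun a _ => by
      have := (hηnull hηθ (z (θ a))).abs
      rw [abs_zero] at this
      exact this.eventually (gt_mem_nhds (by positivity)))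
  obtain ⟨β, hβ, hβdom⟩ := exists_dominated_differences hB hnorm hright hblock
    (x := fun n => z (θ (α n))) (fun n => hz _)
    (fun n => (hθc n).imp fun a ha => ha.comp hα.tendsto_atTop)
    (hθt.imp fun a ha => ha.comp hα.tendsto_atTop)
  let v : ℕ → JamesSpace e := fun k => z (θ (α (β k + 1))) - z (θ (α (β k)))
  let η' : ℕ → StrongDual ℝ (JamesSpace e) := fun k => η (θ (α (β k + 1)))
  have hη' : Dominates e η' := hηθ.subseq hnorm hblock (φ := fun k => α (β k + 1))
    fun i j hij => hα (Nat.succ_lt_succ (hβ hij))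
  have hv : Dominates e v := hβdom
  have hdiag : ∀ k, δ / 4 ≤ η' k (v k) := by
    intro k
    have h1 := hηz (θ (α (β k + 1)))
    have h2 := hαδ (β k) (β k + 1) (Nat.lt_succ_self _)
    have h3 := (le_abs_self _).trans_lt h2
    simp only [η', v, map_sub]
    linarith
  -- Both (v_k) and (η'_k) are weakly null, so both off-diagonal values with larger index j can be
  -- made smaller than 4^(-j) ≤ 2^(-i) 2^(-j).
  obtain ⟨γ, hγ, hγoff⟩ := exists_strictMono_of_eventually
    (Q := fun a j b => |η' a (v b)| < (1 / 4 : ℝ) ^ j ∧ |η' b (v a)| < (1 / 4 : ℝ) ^ j)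
    (fun a j => by
      have h1 := (hnull hv (η' a)).abs
      have h2 := (hηnull hη' (v a)).abs
      rw [abs_zero] at h1 h2
      exact (h1.eventually (gt_mem_nhds (by positivity))).and
        (h2.eventually (gt_mem_nhds (by positivity))))
  have hpow : ∀ i j : ℕ, i ≤ j → (1 / 4 : ℝ) ^ j ≤ (1 / 2 : ℝ) ^ i * (1 / 2 : ℝ) ^ j := by
    intro i j hij
    rw [show (1 / 4 : ℝ) = 1 / 2 * (1 / 2) by norm_num, mul_pow]
    exact mul_le_mul_of_nonneg_right
      (pow_le_pow_of_le_one (by norm_num) (by norm_num) hij) (by positivity)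
  obtain ⟨K, hK, hpair⟩ := exists_pairing_bound hB hnorm (hη'.subseq hnorm hblock hγ)
    (hv.subseq hnorm hblock hγ) (show 0 < δ / 4 by positivity) (fun i => hdiag (γ i))
    (fun i j hij => by
      rcases hij.lt_or_gt with h | h
      · exact (hγoff i j h).1.le.trans (hpow i j h.le)
      · rw [mul_comm]
        exact (hγoff j i h).2.le.trans (hpow j i h.le))
  exact hnd (dominates_biorthogonal_of_pairing he hB hK hpair)

/-! ### A noncompact operator when (e_i) dominates (e'_i) -/

theorem norm_ofFinsupp_single_le (hnorm : IsNormalizedSeq e) (n : ℕ) :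
    ‖ofFinsupp e (Finsupp.single n 1)‖ ≤ 1 := by
  refine norm_ofFinsupp_le fun k p _ hp => ?_
  have hval : ∀ i, ∑ j ∈ Finset.Ico (p i) (p (i + 1)), (Finsupp.single n (1 : ℝ)) j
      = if n ∈ Finset.Ico (p i) (p (i + 1)) then 1 else 0 := fun i => by
    simp [Finsupp.single_apply]
  simp only [jamesRep, hval, ite_smul, one_smul, zero_smul]
  by_cases h : ∃ i ∈ Finset.range k, n ∈ Finset.Ico (p i) (p (i + 1))
  · obtain ⟨i, hi, hni⟩ := h
    rw [Finset.sum_eq_single_of_mem i hi, if_pos hni, hnorm]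
    intro i' _ hne
    refine if_neg fun hni' => hne ?_
    rw [Finset.mem_Ico] at hni hni'
    have h1 := hp.lt_iff_lt.1 (hni.1.trans_lt hni'.2)
    have h2 := hp.lt_iff_lt.1 (hni'.1.trans_lt hni.2)
    omega
  · rw [Finset.sum_eq_zero fun i hi => if_neg fun hni => h ⟨i, hi, hni⟩, norm_zero]
    exact zero_le_one

theorem exists_extension [CompleteSpace Z] (f : (ℕ →₀ ℝ) →ₗ[ℝ] Z)
    (hf : ∃ C : ℝ, ∀ a, ‖f a‖ ≤ C * ‖ofFinsupp e a‖) :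
    ∃ g : JamesSpace e →L[ℝ] Z, ∀ a, g (ofFinsupp e a) = f a :=
  ⟨f.extendOfNorm (ofFinsupp e), LinearMap.extendOfNorm_eq (denseRange_ofFinsupp e) hf⟩

/-- If `(e_i)` dominates its biorthogonal sequence, then `∑ a_i b_i` defines a bounded operator
from the James type space to its dual which maps the unit vectors to the coordinate
functionals. -/
theorem exists_diagonal_operator [CompleteSpace X] (he : IsBasicSequence e)
    (hdom : Dominates e (biorthogonal he)) :
    ∃ T : JamesSpace e →L[ℝ] StrongDual ℝ (JamesSpace e), ∀ i j,
      T (ofFinsupp e (Finsupp.single i 1)) (ofFinsupp e (Finsupp.single j 1))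
        = if i = j then 1 else 0 := by
  have : CompleteSpace (closedSpan e) := (isClosed_closedSpan e).completeSpace_coe
  let incl : (ℕ →₀ ℝ) →ₗ[ℝ] closedSpan e :=
    Finsupp.linearCombination ℝ fun i => ⟨e i, mem_closedSpan e i⟩
  let dual : (ℕ →₀ ℝ) →ₗ[ℝ] StrongDual ℝ (closedSpan e) :=
    Finsupp.linearCombination ℝ (biorthogonal he)
  obtain ⟨C, hC⟩ := hdom
  have hincl : ∃ C : ℝ, ∀ a, ‖incl a‖ ≤ C * ‖ofFinsupp e a‖ := by
    refine ⟨1, fun a => ?_⟩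
    have h1 : (incl a : X) = a.sum fun i t => t • e i := by
      rw [Finsupp.linearCombination_apply, Finsupp.sum, AddSubmonoidClass.coe_finsetSum]
      rfl
    rw [one_mul, Submodule.coe_norm, h1]
    exact norm_sum_smul_le e a
  have hdual : ∃ C : ℝ, ∀ a, ‖dual a‖ ≤ C * ‖ofFinsupp e a‖ := by
    refine ⟨max C 0, fun a => ?_⟩
    have h1 : ‖dual a‖ ≤ C * ‖a.sum fun i t => t • e i‖ := hC a
    refine h1.trans (mul_le_mul (le_max_left _ _) (norm_sum_smul_le e a) (norm_nonneg _)
      (le_max_right _ _))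
  obtain ⟨ι, hι⟩ := exists_extension incl hincl
  obtain ⟨ρ, hρ⟩ := exists_extension (Z := StrongDual ℝ (closedSpan e)) (e := e) dual hdual
  -- This is `ρ : u_i ↦ e'_i` followed by the adjoint of `ι : u_j ↦ e_j`.
  refine ⟨((ContinuousLinearMap.compL ℝ (JamesSpace e) (closedSpan e) ℝ).flip ι).comp ρ,
    fun i j => ?_⟩
  have h1 : ι (ofFinsupp e (Finsupp.single j 1)) = ⟨e j, mem_closedSpan e j⟩ := by
    rw [hι, Finsupp.linearCombination_single, one_smul]
  have h2 : ρ (ofFinsupp e (Finsupp.single i 1)) = biorthogonal he i := by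
    rw [hρ, Finsupp.linearCombination_single, one_smul]
  rw [ContinuousLinearMap.comp_apply, h2, ContinuousLinearMap.flip_apply,
    ContinuousLinearMap.compL_apply, ContinuousLinearMap.comp_apply, h1, biorthogonal_apply]

/-- For m ≠ n, T u_m - T u_n takes the value -1 at u_n, which has norm at most 1, so no subsequence
of (T u_n) converges. -/
theorem not_isCompactOperator_of_separating (hnorm : IsNormalizedSeq e)
    {T : JamesSpace e →L[ℝ] StrongDual ℝ (JamesSpace e)} (hT : ∀ i j,
      T (ofFinsupp e (Finsupp.single i 1)) (ofFinsupp e (Finsupp.single j 1))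
        = if i = j then 1 else 0) : ¬ IsCompactOperator T := by
  intro h
  have hK := (isCompactOperator_iff_isCompact_closure_image_closedBall
    (T : JamesSpace e →ₗ[ℝ] StrongDual ℝ (JamesSpace e)) one_pos).1 h
  obtain ⟨a, -, φ, hφ, ha⟩ := hK.tendsto_subseq (x := fun n => T (ofFinsupp e (Finsupp.single n 1)))
    fun n => subset_closure ⟨_, by simpa using norm_ofFinsupp_single_le hnorm n, rfl⟩
  have h1 := ((ha.comp (tendsto_add_atTop_nat 1)).sub ha).norm
  rw [sub_self, norm_zero] at h1
  refine absurd (ge_of_tendsto h1 (Eventually.of_forall fun k => ?_)) (not_le.2 one_pos)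
  have h2 := ContinuousLinearMap.unit_le_opNorm
    (T (ofFinsupp e (Finsupp.single (φ (k + 1)) 1)) - T (ofFinsupp e (Finsupp.single (φ k) 1)))
    _ (norm_ofFinsupp_single_le hnorm (φ k))
  rw [_root_.sub_apply, hT, hT, if_neg (hφ (Nat.lt_succ_self k)).ne', if_pos rfl] at h2
  simpa using h2

end JamesSpace

end Operators

theorem mainTheorem1 {X : Type*} [NormedAddCommGroup X] [NormedSpace ℝ X] [CompleteSpace X]
    (e : ℕ → X) (he : IsBasicSequence e) (hnorm : IsNormalizedSeq e)
    (hright : IsRightDominant e)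
    (hblock : ∀ w : ℕ → X, IsBlockBasis e w → IsNormalizedSeq w → Dominates e w) :
    (∀ E : Submodule ℝ (JamesSpace e), IsClosed (E : Set (JamesSpace e)) →
        ∀ T : E →L[ℝ] StrongDual ℝ (JamesSpace e), IsCompactOperator T) ↔
      ¬ Dominates e (biorthogonal he) := by
  constructor
  · intro h hdom
    obtain ⟨T, hT⟩ := JamesSpace.exists_diagonal_operator he hdom
    have hc := h ⊤ isClosed_univ (T.comp (Submodule.subtypeL ⊤))
    refine JamesSpace.not_isCompactOperator_of_separating hnorm hT ?_
    exact hc.comp_clm ((ContinuousLinearMap.id ℝ (JamesSpace e)).codRestrict ⊤ fun _ => trivial)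
  · intro hnd E _ T
    exact JamesSpace.isCompactOperator_of_not_dominates he hnorm hright hblock hnd E T
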